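/- **Setting.** Let $d,N\ge 1$ and $F(x)=\frac1N\sum_{i=1}^N f_i(x)$ on $\mathbb R^d$, where $F$ is bounded below and every $f_i$ is twice continuously differentiable, with $f_i$, $\nabla f_i$, $\nabla^2 f_i$ Lipschitz with constants $L_0,L_1,L_2$ (Euclidean and operator norms). Let $M,\alpha,\beta>0$ satisfy $\gamma=\frac{3M-2L_2}{24}-\frac52\beta-\frac54\alpha>0$, put $\tau=\min\{(\frac{L_2+M}{2}+2\beta+2\alpha)^{-1/2},\,(\frac{M+2L_2}{2}+2\alpha)^{-1}\}$, and, for $\epsilon\in(0,1]$, $\epsilon_1=\tau\sqrt\epsilon$. **Algorithm (SVRC, sampling with replacement).** Let $m=\lceil N^{1/3}\rceil$, let $x_0\in\mathbb R^d$, and let $s_0$ be a conventional initial step with $\|s_0\|=\epsilon_1$. In iteration $k=0,1,2,\dots$: if $m\mid k$, set $\tilde x=x_k$, $g_k=\nabla F(x_k)$, $H_k=\nabla^2F(x_k)$ (then $|\xi_H(k)|=N$). Otherwise draw index lists $\xi_g(k),\xi_H(k)$ with entries independent (of each other and of all earlier draws) and uniform on $\{1,\dots,N\}$, and set $$g_k=\tfrac1{|\xi_g(k)|}\sum_{i\in\xi_g(k)}\big(\nabla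 f_i(x_k)-\nabla f_i(\tilde x)\big)+\nabla F(\tilde x),\qquad H_k=\tfrac1{|\xi_H(k)|}\sum_{i\in\xi_H(k)}\big(\nabla^2 f_i(x_k)-\nabla^2 f_i(\tilde x)\big)+\nabla^2F(\tilde x).$$ Let $s_{k+1}$ be a global minimizer of $s\mapsto g_k^\top s+\frac12 s^\top H_ks+\frac M6\|s\|^3$, supplied by a deterministic oracle that depends only on $(g_k,H_k)$; put $x_{k+1}=x_k+s_{k+1}$. If $\max\{\|s_{k+1}\|,\|s_k\|\}\le\epsilon_1$, stop and return $x_{k+1}$. The batch sizes are the least positive integers with $$|\xi_g(k)|\ge\Big(\tfrac{8L_1^2\|x_k-\tilde x\|^2}{\beta^2\max\{\|s_k\|^4,\epsilon_1^4\}}+\tfrac{4L_1\|x_k-\tilde x\|}{3\beta\max\{\|s_k\|^2,\epsilon_1^2\}}\Big)\log\tfrac{2(d+1)}{\zeta},\qquad |\xi_H(k)|\ge\Big(\tfrac{8L_2^2\|x_k-\tilde x\|^2}{\alpha^2\max\{\|s_k\|^2,\epsilon_1^2\}}+\tfrac{4L_2\|x_k-\tilde x\|}{3\alpha\max\{\|s_k\|,\epsilon_1\}}\Big)\log\tfrac{4d}{\zeta}.$$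 **Theorem.** For all $L_2\ge 0$, $M,\alpha,\beta$ as above and all $\Delta\in\mathbb R$ there are constants $C,c>0$, depending only on $L_2,M,\alpha,\beta,\Delta$, such that for all $d$, $N$, $L_0$, $L_1$, $f_1,\dots,f_N$ as above, all $x_0$ with $F(x_0)-\inf F\le\Delta$, and all $\epsilon\in(0,1]$, $\delta\in(0,1)$, the following holds for SVRC under sampling with replacement with $\zeta=c\,\epsilon^{3/2}\delta$. With probability at least $1-\delta$, SVRC stops at some iteration $K$, the returned point satisfies $$\|\nabla F(x_{K+1})\|\le\epsilon,\qquad \nabla^2F(x_{K+1})\succcurlyeq-\sqrt\epsilon\, I,$$ and its total Hessian sample complexity (the one full Hessian computed at the starting point $x_0$ not counted; all later full Hessians counted with $N$ samples each) satisfies $$\sum_{i=1}^{K}|\xi_H(i)|\le\frac{C\,N^{2/3}}{\epsilon^{3/2}}\log\Big(\frac{8d}{\epsilon\delta}\Big).$$ -/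

import Mathlib

open MeasureTheory ProbabilityTheory
open scoped NNReal InnerProductSpace

namespace SVRC

noncomputable section

/-- The Euclidean space of dimension `d`. -/
abbrev Vec (d : ℕ) : Type := EuclideanSpace ℝ (Fin d)

/-- Linear operators on the Euclidean space, with the operator norm. -/
abbrev Op (d : ℕ) : Type := Vec d →L[ℝ] Vec d

/-- The finite-sum objective `F(x) = (1/N) ∑ i, f i x`. -/
def objective {d N : ℕ} (f : Fin N → Vec d → ℝ) (x : Vec d) : ℝ :=
  (N : ℝ)⁻¹ * ∑ i, f i x

/-- The Hessian, as the derivative of the gradient. -/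
def hessian {d : ℕ} (h : Vec d → ℝ) (x : Vec d) : Op d :=
  fderiv ℝ (gradient h) x

/-- `A ⪰ - t I`, as a bound on the quadratic form of `A`. -/
def CurvatureAtLeastNeg {d : ℕ} (A : Op d) (t : ℝ) : Prop :=
  ∀ v : Vec d, -t * ‖v‖ ^ 2 ≤ ⟪v, A v⟫_ℝ

/-- The standing assumption on the objective: `F` is bounded below, and every component is twice
continuously differentiable with `L₀`-Lipschitz values, `L₁`-Lipschitz gradient and
`L₂`-Lipschitz Hessian. -/
structure RegularObjective {d N : ℕ} (f : Fin N → Vec d → ℝ) (L₀ L₁ L₂ : ℝ≥0) : Prop where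
  bddBelow : BddBelow (Set.range (objective f))
  contDiff : ∀ i, ContDiff ℝ 2 (f i)
  lipschitz_value : ∀ i, LipschitzWith L₀ (f i)
  lipschitz_gradient : ∀ i, LipschitzWith L₁ (gradient (f i))
  lipschitz_hessian : ∀ i, LipschitzWith L₂ (hessian (f i))

/-- The cubic model `gᵀ u + (1/2) uᵀ H u + (M/6) ‖u‖³`. -/
def cubicModel {d : ℕ} (M : ℝ) (g : Vec d) (H : Op d) (u : Vec d) : ℝ :=
  ⟪g, u⟫_ℝ + 1 / 2 * ⟪u, H u⟫_ℝ + M / 6 * ‖u‖ ^ 3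

/-- A subproblem oracle: it returns a global minimizer of the cubic model, for every gradient
estimate and every symmetric Hessian estimate. -/
def IsSubproblemOracle {d : ℕ} (M : ℝ) (solve : Vec d → Op d → Vec d) : Prop :=
  ∀ (g : Vec d) (H : Op d), IsSelfAdjoint H →
    ∀ u : Vec d, cubicModel M g H (solve g H) ≤ cubicModel M g H u

/-- The input of the algorithm: the starting point `x₀`, the conventional initial step `s₀`, the
tolerance `ε₁`, the inner-loop length `m`, the subproblem oracle, and the rules that give the
numbers of gradient and Hessian samples as functions of the current iterate `x`, the snapshot `x̃`
and the last step `s` (in this order). -/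
structure Input (d : ℕ) where
  x₀ : Vec d
  s₀ : Vec d
  ε₁ : ℝ
  m : ℕ
  solve : Vec d → Op d → Vec d
  gradBatch : Vec d → Vec d → Vec d → ℕ
  hessBatch : Vec d → Vec d → Vec d → ℕ

/-- The state before iteration `k`: the iterate `x_k`, the step `s_k` that led to it, and the
snapshot of the preceding iteration. -/
structure State (d : ℕ) where
  x : Vec d
  s : Vec d
  snap : Vec d

/-- The mean of `h` over the first `n` indices of the stream `ξ`. -/
def batchMean {N : ℕ} {V : Type*} [AddCommGroup V] [Module ℝ V]
    (n : ℕ) (ξ : ℕ → Fin N) (h : Fin N → V) : V :=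
  (n : ℝ)⁻¹ • ∑ j ∈ Finset.range n, h (ξ j)

/-- The snapshot `x̃` in force in iteration `k`. -/
def snapshot {d : ℕ} (I : Input d) (k : ℕ) (σ : State d) : Vec d :=
  if k % I.m = 0 then σ.x else σ.snap

/-- The gradient estimate `g_k`; `ξ` is the stream of indices drawn for it. -/
def gradEstimate {d N : ℕ} (f : Fin N → Vec d → ℝ) (I : Input d) (k : ℕ) (ξ : ℕ → Fin N)
    (σ : State d) : Vec d :=
  if k % I.m = 0 then gradient (objective f) σ.x
  else
    batchMean (I.gradBatch σ.x (snapshot I k σ) σ.s) ξ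
        (fun i => gradient (f i) σ.x - gradient (f i) (snapshot I k σ))
      + gradient (objective f) (snapshot I k σ)

/-- The Hessian estimate `H_k`; `ξ` is the stream of indices drawn for it. -/
def hessEstimate {d N : ℕ} (f : Fin N → Vec d → ℝ) (I : Input d) (k : ℕ) (ξ : ℕ → Fin N)
    (σ : State d) : Op d :=
  if k % I.m = 0 then hessian (objective f) σ.x
  else
    batchMean (I.hessBatch σ.x (snapshot I k σ) σ.s) ξ
        (fun i => hessian (f i) σ.x - hessian (f i) (snapshot I k σ))
      + hessian (objective f) (snapshot I k σ)

/-- Iteration `k`: solve the cubic subproblem and move. -/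
def step {d N : ℕ} (f : Fin N → Vec d → ℝ) (I : Input d) (k : ℕ) (ξg ξH : ℕ → Fin N)
    (σ : State d) : State d where
  x := σ.x + I.solve (gradEstimate f I k ξg σ) (hessEstimate f I k ξH σ)
  s := I.solve (gradEstimate f I k ξg σ) (hessEstimate f I k ξH σ)
  snap := snapshot I k σ

/-- The state before iteration `k`, when `ξg k` and `ξH k` are the index streams of iteration `k`.
The sequence is continued for ever; where the algorithm stops is said by `StopsAt`. -/
def run {d N : ℕ} (f : Fin N → Vec d → ℝ) (I : Input d) (ξg ξH : ℕ → ℕ → Fin N) : ℕ → State d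
  | 0 => ⟨I.x₀, I.s₀, I.x₀⟩
  | k + 1 => step f I k (ξg k) (ξH k) (run f I ξg ξH k)

/-- The stopping test of iteration `k`: `max {‖s_{k+1}‖, ‖s_k‖} ≤ ε₁`. -/
def StopTest {d N : ℕ} (f : Fin N → Vec d → ℝ) (I : Input d) (ξg ξH : ℕ → ℕ → Fin N)
    (k : ℕ) : Prop :=
  max ‖(run f I ξg ξH (k + 1)).s‖ ‖(run f I ξg ξH k).s‖ ≤ I.ε₁

/-- The algorithm stops in iteration `k`, and returns `x_{k+1}`. -/
def StopsAt {d N : ℕ} (f : Fin N → Vec d → ℝ) (I : Input d) (ξg ξH : ℕ → ℕ → Fin N)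
    (k : ℕ) : Prop :=
  StopTest f I ξg ξH k ∧ ∀ j < k, ¬ StopTest f I ξg ξH j

/-- The number `|ξ_H(k)|` of component Hessians sampled in iteration `k`; an iteration that
computes the full Hessian uses all `N` of them. -/
def hessSamples {d N : ℕ} (f : Fin N → Vec d → ℝ) (I : Input d) (ξg ξH : ℕ → ℕ → Fin N)
    (k : ℕ) : ℕ :=
  if k % I.m = 0 then N
  else
    I.hessBatch (run f I ξg ξH k).x (snapshot I k (run f I ξg ξH k)) (run f I ξg ξH k).s

/-- Sampling with replacement: all indices, for gradients and for Hessians, in all iterations,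
are independent and uniform on the `N` components. -/
structure UniformSampling {Ω : Type*} [MeasurableSpace Ω] (P : Measure Ω) {N : ℕ}
    (ξg ξH : ℕ → ℕ → Ω → Fin N) : Prop where
  measurable_grad : ∀ k j, Measurable (ξg k j)
  measurable_hess : ∀ k j, Measurable (ξH k j)
  uniform_grad : ∀ k j i, P {ω | ξg k j ω = i} = (N : ENNReal)⁻¹
  uniform_hess : ∀ k j i, P {ω | ξH k j ω = i} = (N : ENNReal)⁻¹
  indep : iIndepFun
    (Sum.elim (fun p : ℕ × ℕ => ξg p.1 p.2) (fun p : ℕ × ℕ => ξH p.1 p.2)) P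

/-- The number of gradient samples: the least positive integer that is at least
`(8 L₁² r² / (β² max {‖s‖⁴, ε₁⁴}) + 4 L₁ r / (3 β max {‖s‖², ε₁²})) log (2 (d + 1) / ζ)`,
with `r = ‖x - x̃‖`. -/
def gradBatchSize (d : ℕ) (L₁ β ε₁ ζ : ℝ) (x snap s : Vec d) : ℕ :=
  max 1 ⌈(8 * L₁ ^ 2 / (β ^ 2 * max (‖s‖ ^ 4) (ε₁ ^ 4)) * ‖x - snap‖ ^ 2
      + 4 * L₁ / (3 * β * max (‖s‖ ^ 2) (ε₁ ^ 2)) * ‖x - snap‖)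
    * Real.log (2 * (d + 1) / ζ)⌉₊

/-- The number of Hessian samples: the least positive integer that is at least
`(8 L₂² r² / (α² max {‖s‖², ε₁²}) + 4 L₂ r / (3 α max {‖s‖, ε₁})) log (4 d / ζ)`,
with `r = ‖x - x̃‖`. -/
def hessBatchSize (d : ℕ) (L₂ α ε₁ ζ : ℝ) (x snap s : Vec d) : ℕ :=
  max 1 ⌈(8 * L₂ ^ 2 / (α ^ 2 * max (‖s‖ ^ 2) (ε₁ ^ 2)) * ‖x - snap‖ ^ 2
      + 4 * L₂ / (3 * α * max ‖s‖ ε₁) * ‖x - snap‖)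
    * Real.log (4 * d / ζ)⌉₊

/-- The factor `τ` in the tolerance `ε₁ = τ √ε`. -/
def tau (L₂ M α β : ℝ) : ℝ :=
  min (((L₂ + M) / 2 + 2 * β + 2 * α) ^ (-(1 / 2) : ℝ)) (((M + 2 * L₂) / 2 + 2 * α)⁻¹)

/-- The constant `γ`; the parameters have to make it positive. -/
def gammaConst (L₂ M α β : ℝ) : ℝ :=
  (3 * M - 2 * L₂) / 24 - 5 / 2 * β - 5 / 4 * α

/-- The inner-loop length `N ^ (1/3)`, rounded up. -/
def loopLength (N : ℕ) : ℕ := ⌈(N : ℝ) ^ (1 / 3 : ℝ)⌉₊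

/-- The input for accuracy `ε`: tolerance `ε₁ = τ √ε`, inner loops of length `N ^ (1/3)`, and the
batch sizes above at failure level `ζ` per estimate. -/
def input {d : ℕ} (N : ℕ) (L₁ L₂ M α β ε ζ : ℝ) (x₀ s₀ : Vec d)
    (solve : Vec d → Op d → Vec d) : Input d where
  x₀ := x₀
  s₀ := s₀
  ε₁ := tau L₂ M α β * √ε
  m := loopLength N
  solve := solve
  gradBatch := gradBatchSize d L₁ β (tau L₂ M α β * √ε) ζ
  hessBatch := hessBatchSize d L₂ α (tau L₂ M α β * √ε) ζ

end

end SVRC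

/-!
Write `r = ‖x_k - x̃‖`. The proof has a probabilistic and a deterministic half, which meet in the
event `Accurate`: the gradient estimate errs by at most `β max {‖s_k‖², ε₁²}` and the Hessian
estimate by at most `α max {‖s_k‖, ε₁}`.

**Probability.** A batch mean deviates by an average of `n` independent centred matrices of norm at
most `2 L₂ r`, and a bound with only logarithmic dependence on the dimension is needed. Instead of
Lieb's theorem or the Golden–Thompson inequality, the moments `E tr S²ᵖ` of the sum `S` are bounded
by the method of exchangeable pairs. Resampling one summand turns `E tr S²ᵐ⁺²` into expectations of
`tr ((X - Y) (X²ᵐ⁺¹ - Y²ᵐ⁺¹))`, where `X` and `Y` are two copies of the sum differing in one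
summand; in eigenbases of `X` and `Y` this is controlled by a scalar inequality
(`trace_sub_mul_pow_sub_pow_le`). Iterating gives `E tr S²ᵖ ≤ d (2 p n L₂² r²)ᵖ`
(`sum_trace_pow_le`), and Markov's inequality with `p = ⌈log (4 d / ζ)⌉` gives the tail bound
(`card_norm_sum_le`). Gradients are reduced to symmetric operators in dimension `d + 1` by
self-adjoint dilation. Everything here is a count over the finitely many sample lists. To pass to
the algorithm, where the batch size depends on the past, one uses that the state before iteration
`k` takes finitely many values, each on an event generated by earlier samples, so that the fresh
samples remain uniform given the state (`measureReal_bad_batch_le`). Hence an iteration is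
inaccurate with probability at most `ζ`.

**Determinism.** A global minimizer `s` of the cubic model satisfies `g + H s + (M/2) ‖s‖ s = 0` and
`H + (M/2) ‖s‖ I ⪰ 0`, and has model value at most `-(M/12) ‖s‖³`. With Taylor's formula the
objective decreases in an accurate iteration by a multiple of `‖s_{k+1}‖³`, up to errors of order
`‖s_k‖³ + ‖s_{k+1}‖³ + ε₁³`. While the stopping test fails, `ε₁³ ≤ ‖s_k‖³ + ‖s_{k+1}‖³`, so
`γ > 0` makes the decrease win: `∑ ‖s_k‖³` is bounded by a constant (`sum_norm_step_cube_le`) and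
the number of iterations is `O(ε^{-3/2})` (`iteration_count_le`). So `O(ε^{-3/2})` events of
probability `ζ = c ε^{3/2} δ` have to be avoided, which fixes `c`. When the test succeeds, both
steps are at most `ε₁`, and the optimality conditions of the model give the two conclusions on
`x_{K+1}` (`approximate_minimizer_of_stopTest`).

**Counting samples.** The full Hessians cost `N K / m ≤ N^{2/3} K`. A batch costs
`O((1 + r²/ε₁²) log)`. By Cauchy–Schwarz `r²` is at most `m` times the sum of the `‖s_j‖²` since
the snapshot, and each step occurs in at most `m` of these sums, so `∑ r² ≤ m² ∑ ‖s_j‖²`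
(`sum_sq_drift_le`). Since `y² ≤ 1 + y³`, the right-hand side is at most
`m² ε₁² (K + ∑ ‖s_j‖³ / ε₁³) = O(N^{2/3} ε₁² ε^{-3/2})`.
-/

namespace SVRC

/-! ### A trace inequality for powers of symmetric operators -/

theorem mul_pow_add_mul_pow_le (a b : ℝ) {q r m : ℕ} (h : q + r = 2 * m) :
    a ^ q * b ^ r + a ^ r * b ^ q ≤ a ^ (2 * m) + b ^ (2 * m) := by
  have key : 0 ≤ (|a| ^ q - |b| ^ q) * (|a| ^ r - |b| ^ r) := by
    rcases le_total |a| |b| with hab | hab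
    · exact mul_nonneg_of_nonpos_of_nonpos
        (sub_nonpos.2 (pow_le_pow_left₀ (abs_nonneg a) hab q))
        (sub_nonpos.2 (pow_le_pow_left₀ (abs_nonneg a) hab r))
    · exact mul_nonneg
        (sub_nonneg.2 (pow_le_pow_left₀ (abs_nonneg b) hab q))
        (sub_nonneg.2 (pow_le_pow_left₀ (abs_nonneg b) hab r))
  have h1 : a ^ q * b ^ r ≤ |a| ^ q * |b| ^ r := by
    rw [← abs_pow, ← abs_pow, ← abs_mul]; exact le_abs_self _
  have h2 : a ^ r * b ^ q ≤ |a| ^ r * |b| ^ q := by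
    rw [← abs_pow, ← abs_pow, ← abs_mul]; exact le_abs_self _
  have h3 : ∀ x : ℝ, x ^ (2 * m) = |x| ^ q * |x| ^ r := fun x => by
    rw [← pow_add, h, pow_mul, pow_mul, sq_abs]
  rw [h3 a, h3 b]
  linarith

theorem sub_mul_pow_sub_pow_le (a b : ℝ) (m : ℕ) :
    (a - b) * (a ^ (2 * m + 1) - b ^ (2 * m + 1))
      ≤ (2 * m + 1) / 2 * ((a - b) ^ 2 * (a ^ (2 * m) + b ^ (2 * m))) := by
  have hg := (Commute.all a b).mul_geom_sum₂ (2 * m + 1)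
  set G := ∑ i ∈ Finset.range (2 * m + 1), a ^ i * b ^ (2 * m + 1 - 1 - i) with hG
  have hG' : G = ∑ i ∈ Finset.range (2 * m + 1), a ^ (2 * m - i) * b ^ i := by
    rw [hG, ← Finset.sum_range_reflect]
    refine Finset.sum_congr rfl fun i hi => ?_
    have : i < 2 * m + 1 := Finset.mem_range.1 hi
    congr 2; omega
  have h2 : 2 * G ≤ (2 * m + 1) * (a ^ (2 * m) + b ^ (2 * m)) := by
    have : 2 * G = ∑ i ∈ Finset.range (2 * m + 1),
        (a ^ i * b ^ (2 * m - i) + a ^ (2 * m - i) * b ^ i) := by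
      rw [Finset.sum_add_distrib, ← hG', hG, two_mul]
      simp
    rw [this]
    calc _ ≤ ∑ i ∈ Finset.range (2 * m + 1), (a ^ (2 * m) + b ^ (2 * m)) :=
          Finset.sum_le_sum fun i hi => mul_pow_add_mul_pow_le a b (by
            have : i < 2 * m + 1 := Finset.mem_range.1 hi
            omega)
      _ = _ := by simp [mul_add]
  rw [← hg]
  nlinarith [mul_le_mul_of_nonneg_left h2 (sq_nonneg (a - b))]

section Trace

variable {E : Type*} [NormedAddCommGroup E] [InnerProductSpace ℝ E]

theorem pow_apply_of_apply_eq_smul {T : Module.End ℝ E} {v : E} {c : ℝ} (h : T v = c • v) (k : ℕ) :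
    (T ^ k) v = c ^ k • v := by
  induction k with
  | zero => simp
  | succ k ih => rw [pow_succ, Module.End.mul_apply, h, map_smul, ih, smul_smul, pow_succ']

/-- An orthonormal eigenbasis of a symmetric operator, with a fixed index type. -/
theorem exists_eigenbasis [FiniteDimensional ℝ E] {T : Module.End ℝ E} (hT : T.IsSymmetric) :
    ∃ (u : OrthonormalBasis (Fin (Module.finrank ℝ E)) ℝ E)
      (c : Fin (Module.finrank ℝ E) → ℝ), ∀ i, T (u i) = c i • u i :=
  ⟨hT.eigenvectorBasis rfl, hT.eigenvalues rfl, fun i => hT.apply_eigenvectorBasis rfl i⟩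

variable {ι : Type*} [Fintype ι]

theorem trace_pow_eq_sum {T : Module.End ℝ E} {u : OrthonormalBasis ι ℝ E} {c : ι → ℝ}
    (hu : ∀ i, T (u i) = c i • u i) (k : ℕ) :
    LinearMap.trace ℝ E (T ^ k) = ∑ i, c i ^ k := by
  rw [LinearMap.trace_eq_sum_inner _ u]
  refine Finset.sum_congr rfl fun i _ => ?_
  rw [pow_apply_of_apply_eq_smul (hu i), real_inner_smul_right, real_inner_self_eq_norm_sq,
    u.norm_eq_one]
  simp

theorem trace_pow_mul_pow {X Y : Module.End ℝ E} (hX : X.IsSymmetric)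
    {u w : OrthonormalBasis ι ℝ E} {c b : ι → ℝ}
    (hu : ∀ i, X (u i) = c i • u i) (hw : ∀ i, Y (w i) = b i • w i) (p q : ℕ) :
    LinearMap.trace ℝ E (X ^ p * Y ^ q)
      = ∑ j, ∑ i, c i ^ p * b j ^ q * ⟪u i, w j⟫_ℝ ^ 2 := by
  rw [LinearMap.trace_eq_sum_inner _ w]
  refine Finset.sum_congr rfl fun j _ => ?_
  rw [Module.End.mul_apply, pow_apply_of_apply_eq_smul (hw j), map_smul, real_inner_smul_right,
    ← u.sum_inner_mul_inner, Finset.mul_sum]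
  refine Finset.sum_congr rfl fun i _ => ?_
  rw [← (hX.pow p) (u i), pow_apply_of_apply_eq_smul (hu i), real_inner_smul_left,
    real_inner_comm (w j)]
  rw [real_inner_comm (u i) (w j)]
  ring

/-- `tr (C² X²ᵐ) ≤ ‖C‖² tr X²ᵐ`, with the left-hand side written in an eigenbasis of `X`. -/
theorem sum_sq_mul_pow_le {X C : Module.End ℝ E} {u : OrthonormalBasis ι ℝ E} {c : ι → ℝ}
    (hu : ∀ i, X (u i) = c i • u i) {R : ℝ} (hC : ∀ v, ‖C v‖ ≤ R * ‖v‖) (m : ℕ) :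
    ∑ i, c i ^ (2 * m) * ‖C (u i)‖ ^ 2 ≤ R ^ 2 * LinearMap.trace ℝ E (X ^ (2 * m)) := by
  rw [trace_pow_eq_sum hu, Finset.mul_sum]
  refine Finset.sum_le_sum fun i _ => ?_
  rw [mul_comm]
  have h1 : ‖C (u i)‖ ≤ R := by simpa [u.norm_eq_one] using hC (u i)
  have h2 : ‖C (u i)‖ ^ 2 ≤ R ^ 2 := pow_le_pow_left₀ (norm_nonneg _) h1 2
  have h3 : 0 ≤ c i ^ (2 * m) := by rw [pow_mul]; positivity
  exact mul_le_mul_of_nonneg_right h2 h3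

theorem norm_sub_apply_sq {X Y : Module.End ℝ E} (hY : Y.IsSymmetric)
    {w : OrthonormalBasis ι ℝ E} {b : ι → ℝ} {x : E} {a : ℝ}
    (hx : X x = a • x) (hw : ∀ i, Y (w i) = b i • w i) :
    ‖(X - Y) x‖ ^ 2 = ∑ j, (a - b j) ^ 2 * ⟪x, w j⟫_ℝ ^ 2 := by
  rw [← w.sum_sq_norm_inner_right]
  refine Finset.sum_congr rfl fun j _ => ?_
  rw [LinearMap.sub_apply, inner_sub_right, ← hY (w j), hx, hw, real_inner_smul_right,
    real_inner_smul_left, ← sub_mul, norm_mul, mul_pow, real_inner_comm]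
  simp

/-- The mean value inequality for the trace of an odd power. In eigenbases of `X` and `Y` both
sides are sums over pairs of eigenvalues with the same nonnegative weights, so the scalar
inequality suffices. -/
theorem trace_sub_mul_pow_sub_pow_le [FiniteDimensional ℝ E] {X Y : Module.End ℝ E}
    (hX : X.IsSymmetric) (hY : Y.IsSymmetric) {R : ℝ} (hR : ∀ v, ‖(X - Y) v‖ ≤ R * ‖v‖) (m : ℕ) :
    LinearMap.trace ℝ E ((X - Y) * (X ^ (2 * m + 1) - Y ^ (2 * m + 1)))
      ≤ (2 * m + 1) / 2 * R ^ 2 *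
        (LinearMap.trace ℝ E (X ^ (2 * m)) + LinearMap.trace ℝ E (Y ^ (2 * m))) := by
  obtain ⟨u, c, hu⟩ := exists_eigenbasis hX
  obtain ⟨w, b, hw⟩ := exists_eigenbasis hY
  have e1 : (X - Y) * (X ^ (2 * m + 1) - Y ^ (2 * m + 1))
      = X ^ (2 * m + 2) * Y ^ 0 - X ^ 1 * Y ^ (2 * m + 1) - Y * X ^ (2 * m + 1)
        + X ^ 0 * Y ^ (2 * m + 2) := by
    simp only [pow_zero, pow_one, mul_one, one_mul]
    rw [pow_succ' X (2 * m + 1), pow_succ' Y (2 * m + 1)]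
    noncomm_ring
  have e2 : LinearMap.trace ℝ E ((X - Y) * (X ^ (2 * m + 1) - Y ^ (2 * m + 1)))
      = ∑ j, ∑ i, (c i - b j) * (c i ^ (2 * m + 1) - b j ^ (2 * m + 1)) * ⟪u i, w j⟫_ℝ ^ 2 := by
    rw [e1, map_add, map_sub, map_sub, LinearMap.trace_mul_comm ℝ Y,
      show X ^ (2 * m + 1) * Y = X ^ (2 * m + 1) * Y ^ 1 by rw [pow_one]]
    simp only [trace_pow_mul_pow hX hu hw, ← Finset.sum_sub_distrib, ← Finset.sum_add_distrib]
    refine Finset.sum_congr rfl fun j _ => Finset.sum_congr rfl fun i _ => ?_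
    ring
  have e3 := sum_sq_mul_pow_le hu hR m
  have hR' : ∀ v, ‖(Y - X) v‖ ≤ R * ‖v‖ := fun v => by
    rw [← neg_sub, LinearMap.neg_apply, norm_neg]; exact hR v
  have e4 := sum_sq_mul_pow_le hw hR' m
  have e5 : ∑ i, c i ^ (2 * m) * ‖(X - Y) (u i)‖ ^ 2
      = ∑ j, ∑ i, (c i - b j) ^ 2 * c i ^ (2 * m) * ⟪u i, w j⟫_ℝ ^ 2 := by
    rw [Finset.sum_comm]
    refine Finset.sum_congr rfl fun i _ => ?_
    rw [norm_sub_apply_sq hY (hu i) hw, Finset.mul_sum]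
    refine Finset.sum_congr rfl fun j _ => ?_
    ring
  have e6 : ∑ j, b j ^ (2 * m) * ‖(Y - X) (w j)‖ ^ 2
      = ∑ j, ∑ i, (c i - b j) ^ 2 * b j ^ (2 * m) * ⟪u i, w j⟫_ℝ ^ 2 := by
    refine Finset.sum_congr rfl fun j _ => ?_
    rw [norm_sub_apply_sq hX (hw j) hu, Finset.mul_sum]
    refine Finset.sum_congr rfl fun i _ => ?_
    rw [real_inner_comm]
    ring
  rw [e5] at e3
  rw [e6] at e4
  calc LinearMap.trace ℝ E ((X - Y) * (X ^ (2 * m + 1) - Y ^ (2 * m + 1)))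
      ≤ ∑ j, ∑ i, (2 * m + 1) / 2 * ((c i - b j) ^ 2 * (c i ^ (2 * m) + b j ^ (2 * m)))
          * ⟪u i, w j⟫_ℝ ^ 2 := by
        rw [e2]
        exact Finset.sum_le_sum fun j _ => Finset.sum_le_sum fun i _ =>
          mul_le_mul_of_nonneg_right (sub_mul_pow_sub_pow_le _ _ m) (sq_nonneg _)
    _ = (2 * m + 1) / 2 * (∑ j, ∑ i, (c i - b j) ^ 2 * c i ^ (2 * m) * ⟪u i, w j⟫_ℝ ^ 2
          + ∑ j, ∑ i, (c i - b j) ^ 2 * b j ^ (2 * m) * ⟪u i, w j⟫_ℝ ^ 2) := by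
        simp only [← Finset.sum_add_distrib, Finset.mul_sum]
        refine Finset.sum_congr rfl fun j _ => Finset.sum_congr rfl fun i _ => ?_
        ring
    _ ≤ (2 * m + 1) / 2 * (R ^ 2 * LinearMap.trace ℝ E (X ^ (2 * m))
          + R ^ 2 * LinearMap.trace ℝ E (Y ^ (2 * m))) := by gcongr
    _ = _ := by ring

theorem pow_le_trace_pow [FiniteDimensional ℝ E] {T : Module.End ℝ E}
    (hT : T.IsSymmetric) {r : ℝ} (hr : 0 ≤ r) {v : E} (hv : r * ‖v‖ < ‖T v‖) (p : ℕ) :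
    r ^ (2 * p) ≤ LinearMap.trace ℝ E (T ^ (2 * p)) := by
  obtain ⟨u, c, hu⟩ := exists_eigenbasis hT
  have h0 : ∀ i, 0 ≤ c i ^ (2 * p) := fun i => by rw [pow_mul]; positivity
  obtain ⟨i, hi⟩ : ∃ i, r < |c i| := by
    by_contra! h
    refine absurd hv (not_lt.2 ?_)
    refine le_of_sq_le_sq ?_ (by positivity)
    rw [← u.sum_sq_norm_inner_right, mul_pow, ← u.sum_sq_norm_inner_right v, Finset.mul_sum]
    refine Finset.sum_le_sum fun i _ => ?_
    rw [← hT (u i), hu, real_inner_smul_left, norm_mul, mul_pow]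
    refine mul_le_mul_of_nonneg_right ?_ (sq_nonneg _)
    exact pow_le_pow_left₀ (norm_nonneg _) (h i) 2
  rw [trace_pow_eq_sum hu]
  calc r ^ (2 * p) ≤ |c i| ^ (2 * p) := pow_le_pow_left₀ hr hi.le _
    _ = c i ^ (2 * p) := by rw [pow_mul, sq_abs, pow_mul]
    _ ≤ _ := Finset.single_le_sum (f := fun i => c i ^ (2 * p)) (fun i _ => h0 i)
      (Finset.mem_univ i)

end Trace

/-! ### Moments of sums of independent symmetric operators -/

/-- Exchanging the `j`-th sample with a fresh one permutes the pairs (sample, fresh index). -/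
theorem sum_sum_update_swap {α κ V : Type*} [Fintype α] [Fintype κ] [DecidableEq κ]
    [AddCommMonoid V] (j : κ) (G : (κ → α) → α → V) :
    ∑ ω : κ → α, ∑ a, G ω a = ∑ ω : κ → α, ∑ a, G (Function.update ω j a) (ω j) := by
  classical
  rw [← Fintype.sum_prod_type', ← Fintype.sum_prod_type']
  have hinv : Function.Involutive
      (fun p : (κ → α) × α => (Function.update p.1 j p.2, p.1 j)) := by
    rintro ⟨ω, a⟩
    simp
  exact (Equiv.sum_comp hinv.toPerm (fun p : (κ → α) × α => G p.1 p.2)).symm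

section Moments

variable {E : Type*} [NormedAddCommGroup E] [InnerProductSpace ℝ E]

theorem isSymmetric_sum {β : Type*} {A : β → Module.End ℝ E} (hA : ∀ a, (A a).IsSymmetric)
    (s : Finset β) : (∑ j ∈ s, A j).IsSymmetric := by
  classical
  induction s using Finset.induction_on with
  | empty => simp
  | insert a s ha ih => rw [Finset.sum_insert ha]; exact (hA a).add ih

variable [FiniteDimensional ℝ E] {α κ : Type*} [Fintype α] [Nonempty α] [Fintype κ] [DecidableEq κ]

/-- One summand of `tr S²ᵐ⁺²`. Averaging over a fresh copy of the `j`-th sample makes the summand a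
difference of traces for the two exchangeable sums, to which the mean value inequality applies. -/
theorem sum_trace_mul_pow_le {A : α → Module.End ℝ E}
    (hA : ∀ a, (A a).IsSymmetric)
    (h0 : ∑ a, A a = 0) {R : ℝ} (hR : ∀ a b v, ‖(A a - A b) v‖ ≤ R * ‖v‖) (m : ℕ) (j : κ) :
    ∑ ω : κ → α, LinearMap.trace ℝ E (A (ω j) * (∑ i, A (ω i)) ^ (2 * m + 1))
      ≤ (2 * m + 1) * (R ^ 2 / 2) *
        ∑ ω : κ → α, LinearMap.trace ℝ E ((∑ i, A (ω i)) ^ (2 * m)) := by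
  set S : (κ → α) → Module.End ℝ E := fun ω => ∑ i, A (ω i) with hS
  have hSs : ∀ ω, (S ω).IsSymmetric := fun ω => isSymmetric_sum (fun i => hA (ω i)) _
  have hdiff : ∀ ω a, S ω - S (Function.update ω j a) = A (ω j) - A a := by
    intro ω a
    simp only [hS, ← Finset.sum_sub_distrib]
    rw [Finset.sum_eq_single j]
    · simp
    · intro i _ hi
      simp [Function.update_of_ne hi]
    · simp
  have hN : (0 : ℝ) < Fintype.card α := by exact_mod_cast Fintype.card_pos
  -- the fresh copy has mean zero, so it can be subtracted for free
  have e1 : (Fintype.card α : ℝ) * ∑ ω, LinearMap.trace ℝ E (A (ω j) * S ω ^ (2 * m + 1))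
      = ∑ ω : κ → α, ∑ a, LinearMap.trace ℝ E ((A (ω j) - A a) * S ω ^ (2 * m + 1)) := by
    rw [Finset.mul_sum]
    refine Finset.sum_congr rfl fun ω _ => ?_
    rw [← map_sum, ← Finset.sum_mul, Finset.sum_sub_distrib, h0, sub_zero, Finset.sum_const,
      Finset.card_univ, ← Nat.cast_smul_eq_nsmul ℝ, smul_mul_assoc, map_smul, smul_eq_mul]
  have e2 : ∑ ω : κ → α, ∑ a, LinearMap.trace ℝ E ((A (ω j) - A a) * S ω ^ (2 * m + 1))
      = -∑ ω : κ → α, ∑ a, LinearMap.trace ℝ E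
          ((A (ω j) - A a) * S (Function.update ω j a) ^ (2 * m + 1)) := by
    rw [sum_sum_update_swap j, ← Finset.sum_neg_distrib]
    refine Finset.sum_congr rfl fun ω _ => ?_
    rw [← Finset.sum_neg_distrib]
    refine Finset.sum_congr rfl fun a _ => ?_
    rw [Function.update_self, ← map_neg, ← neg_mul, neg_sub]
  have e3 : 2 * ∑ ω : κ → α, ∑ a, LinearMap.trace ℝ E ((A (ω j) - A a) * S ω ^ (2 * m + 1))
      = ∑ ω : κ → α, ∑ a, LinearMap.trace ℝ E ((S ω - S (Function.update ω j a))
          * (S ω ^ (2 * m + 1) - S (Function.update ω j a) ^ (2 * m + 1))) := by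
    rw [two_mul]
    nth_rewrite 2 [e2]
    rw [← sub_eq_add_neg, ← Finset.sum_sub_distrib]
    refine Finset.sum_congr rfl fun ω _ => ?_
    rw [← Finset.sum_sub_distrib]
    refine Finset.sum_congr rfl fun a _ => ?_
    rw [hdiff, ← map_sub, mul_sub]
  have e4 : ∑ ω : κ → α, ∑ a, LinearMap.trace ℝ E ((S ω - S (Function.update ω j a))
          * (S ω ^ (2 * m + 1) - S (Function.update ω j a) ^ (2 * m + 1)))
      ≤ ∑ ω : κ → α, ∑ a : α, (2 * m + 1) / 2 * R ^ 2 * (LinearMap.trace ℝ E (S ω ^ (2 * m))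
          + LinearMap.trace ℝ E (S (Function.update ω j a) ^ (2 * m))) :=
    Finset.sum_le_sum fun ω _ => Finset.sum_le_sum fun a _ =>
      trace_sub_mul_pow_sub_pow_le (hSs _) (hSs _)
        (fun v => by rw [hdiff]; exact hR _ _ v) m
  have e5 : ∑ ω : κ → α, ∑ a : α, LinearMap.trace ℝ E (S (Function.update ω j a) ^ (2 * m))
      = ∑ ω : κ → α, ∑ _a : α, LinearMap.trace ℝ E (S ω ^ (2 * m)) :=
    (sum_sum_update_swap j (fun ω _ => LinearMap.trace ℝ E (S ω ^ (2 * m)))).symm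
  have e6 : ∑ ω : κ → α, ∑ _a : α, LinearMap.trace ℝ E (S ω ^ (2 * m))
      = Fintype.card α * ∑ ω : κ → α, LinearMap.trace ℝ E (S ω ^ (2 * m)) := by
    rw [Finset.mul_sum]
    refine Finset.sum_congr rfl fun ω _ => ?_
    rw [Finset.sum_const, Finset.card_univ, nsmul_eq_mul]
  simp only [← Finset.mul_sum, Finset.sum_add_distrib] at e4
  rw [e5, e6] at e4
  refine le_of_mul_le_mul_left ?_ hN
  rw [e1]
  nlinarith [e3, e4]

theorem sum_trace_pow_add_two_le {A : α → Module.End ℝ E} (hA : ∀ a, (A a).IsSymmetric)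
    (h0 : ∑ a, A a = 0) {R : ℝ} (hR : ∀ a b v, ‖(A a - A b) v‖ ≤ R * ‖v‖) (m : ℕ) :
    ∑ ω : κ → α, LinearMap.trace ℝ E ((∑ i, A (ω i)) ^ (2 * (m + 1)))
      ≤ (2 * m + 1) * (Fintype.card κ * (R ^ 2 / 2)) *
        ∑ ω : κ → α, LinearMap.trace ℝ E ((∑ i, A (ω i)) ^ (2 * m)) := by
  have e : ∀ ω : κ → α, LinearMap.trace ℝ E ((∑ i, A (ω i)) ^ (2 * (m + 1)))
      = ∑ j, LinearMap.trace ℝ E (A (ω j) * (∑ i, A (ω i)) ^ (2 * m + 1)) := fun ω => by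
    rw [← map_sum, ← Finset.sum_mul, ← pow_succ']
    rfl
  simp only [e]
  rw [Finset.sum_comm]
  refine (Finset.sum_le_sum fun j _ => sum_trace_mul_pow_le hA h0 hR m j).trans (le_of_eq ?_)
  rw [Finset.sum_const, Finset.card_univ, nsmul_eq_mul]
  ring

theorem two_mul_add_one_mul_pow_le (p : ℕ) :
    (2 * p + 1 : ℝ) * (p : ℝ) ^ p ≤ ((p : ℝ) + 1) ^ (p + 1) := by
  rcases Nat.eq_zero_or_pos p with rfl | hp
  · simp
  have hp' : (0 : ℝ) < p := by exact_mod_cast hp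
  have h := one_add_mul_le_pow (a := (1 / p : ℝ)) (by have : 0 < (1 / p : ℝ) := by positivity
                                                      linarith) p
  have h2 : 2 * (p : ℝ) ^ p ≤ (p + 1 : ℝ) ^ p := by
    have e : (p + 1 : ℝ) ^ p = (p : ℝ) ^ p * (1 + 1 / p) ^ p := by
      rw [← mul_pow]; congr 1; field_simp
    rw [e, mul_comm]
    refine mul_le_mul_of_nonneg_left ?_ (by positivity)
    calc (2 : ℝ) = 1 + p * (1 / p) := by field_simp; norm_num
      _ ≤ _ := h
  have h3 : 0 < (p : ℝ) ^ p := by positivity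
  calc (2 * p + 1 : ℝ) * (p : ℝ) ^ p ≤ (p + 1) * (2 * (p : ℝ) ^ p) := by nlinarith
    _ ≤ (p + 1) * (p + 1 : ℝ) ^ p := by gcongr
    _ = _ := by ring

/-- The moment bound `E tr S²ᵖ ≤ d (p n R² / 2)ᵖ`. It uses `(2p-1)!! ≤ pᵖ`. -/
theorem sum_trace_pow_le {A : α → Module.End ℝ E} (hA : ∀ a, (A a).IsSymmetric)
    (h0 : ∑ a, A a = 0) {R : ℝ} (hR : ∀ a b v, ‖(A a - A b) v‖ ≤ R * ‖v‖) (p : ℕ) :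
    ∑ ω : κ → α, LinearMap.trace ℝ E ((∑ i, A (ω i)) ^ (2 * p))
      ≤ (p * (Fintype.card κ * (R ^ 2 / 2))) ^ p *
        (Module.finrank ℝ E * Fintype.card (κ → α)) := by
  induction p with
  | zero =>
    simp [mul_comm]
  | succ p ih =>
    have h := sum_trace_pow_add_two_le (κ := κ) hA h0 hR p
    set v : ℝ := Fintype.card κ * (R ^ 2 / 2) with hv
    have hv0 : 0 ≤ v := by positivity
    refine h.trans ((mul_le_mul_of_nonneg_left ih (by positivity)).trans ?_)
    have := two_mul_add_one_mul_pow_le p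
    calc (2 * p + 1) * v * ((p * v) ^ p * (Module.finrank ℝ E * Fintype.card (κ → α)))
        = ((2 * p + 1) * (p : ℝ) ^ p) * (v ^ (p + 1) *
            (Module.finrank ℝ E * Fintype.card (κ → α))) := by
          rw [mul_pow]; ring
      _ ≤ ((p : ℝ) + 1) ^ (p + 1) * (v ^ (p + 1) *
            (Module.finrank ℝ E * Fintype.card (κ → α))) :=
          mul_le_mul_of_nonneg_right this (by positivity)
      _ = _ := by push_cast; rw [mul_pow ((p : ℝ) + 1) v]; ring

/-- Tail bound for a sum of `n` uniform samples with replacement from a centred family of symmetric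
operators: if `n t² ≥ 2 R² ℓ`, then all but a fraction `d e^{-ℓ}` of the sample lists give a sum of
operator norm at most `n t`. -/
theorem card_norm_sum_le {A : α → E →L[ℝ] E}
    (hA : ∀ a, (A a : E →ₗ[ℝ] E).IsSymmetric)
    (h0 : ∑ a, A a = 0) {R t l : ℝ} (hR : ∀ a b, ‖A a - A b‖ ≤ R) (ht : 0 < t) (hl : 3 ≤ l)
    (hκ : 0 < Fintype.card κ) (hn : 2 * R ^ 2 * l ≤ Fintype.card κ * t ^ 2) :
    (Nat.card {ω : κ → α // Fintype.card κ * t < ‖∑ i, A (ω i)‖} : ℝ)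
      ≤ Module.finrank ℝ E * Real.exp (-l) * Fintype.card (κ → α) := by
  classical
  set n : ℝ := (Fintype.card κ : ℝ) with hndef
  have hn0 : 0 < n := by rw [hndef]; exact_mod_cast hκ
  set p := ⌈l⌉₊ with hp
  have hpl : l ≤ p := Nat.le_ceil l
  have hpl' : (p : ℝ) < l + 1 := Nat.ceil_lt_add_one (by linarith)
  have hp0 : (0 : ℝ) < p := by linarith
  set A' : α → Module.End ℝ E := fun a => (A a : E →ₗ[ℝ] E) with hA'
  have hsum : ∀ (s : Finset κ) (ω : κ → α), ∑ i ∈ s, A' (ω i) = ((∑ i ∈ s, A (ω i) : E →L[ℝ] E)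
      : E →ₗ[ℝ] E) := fun s ω => by simp [hA']
  have h0' : ∑ a, A' a = 0 := by
    have : ∑ a, A' a = ((∑ a, A a : E →L[ℝ] E) : E →ₗ[ℝ] E) := by simp [hA']
    rw [this, h0]; rfl
  have hR' : ∀ a b v, ‖(A' a - A' b) v‖ ≤ R * ‖v‖ := fun a b v =>
    ((A a - A b).le_opNorm v).trans (mul_le_mul_of_nonneg_right (hR a b) (norm_nonneg _))
  have hmom := sum_trace_pow_le (κ := κ) hA h0' hR' p
  have hSs : ∀ ω : κ → α, (∑ i, A' (ω i)).IsSymmetric :=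
    fun ω => isSymmetric_sum (fun i => hA (ω i)) _
  have hnn : ∀ ω : κ → α, 0 ≤ LinearMap.trace ℝ E ((∑ i, A' (ω i)) ^ (2 * p)) := fun ω => by
    obtain ⟨u, c, hu⟩ := exists_eigenbasis (hSs ω)
    rw [trace_pow_eq_sum hu]
    exact Finset.sum_nonneg fun i _ => by rw [pow_mul]; positivity
  set B := Finset.univ.filter (fun ω : κ → α => n * t < ‖∑ i, A (ω i)‖) with hB
  have hcard : Nat.card {ω : κ → α // n * t < ‖∑ i, A (ω i)‖} = B.card := by
    rw [Nat.card_eq_fintype_card, Fintype.card_subtype]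
  rw [hcard]
  have hmarkov : (B.card : ℝ) * (n * t) ^ (2 * p)
      ≤ ∑ ω : κ → α, LinearMap.trace ℝ E ((∑ i, A' (ω i)) ^ (2 * p)) := by
    calc (B.card : ℝ) * (n * t) ^ (2 * p) = ∑ ω ∈ B, (n * t) ^ (2 * p) := by
          rw [Finset.sum_const, nsmul_eq_mul]
      _ ≤ ∑ ω ∈ B, LinearMap.trace ℝ E ((∑ i, A' (ω i)) ^ (2 * p)) := by
          refine Finset.sum_le_sum fun ω hω => ?_
          have hω' : n * t < ‖∑ i, A (ω i)‖ := (Finset.mem_filter.1 hω).2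
          obtain ⟨v, hv⟩ : ∃ v, n * t * ‖v‖ < ‖(∑ i, A (ω i)) v‖ := by
            by_contra! h
            exact absurd (ContinuousLinearMap.opNorm_le_bound _ (by positivity) h)
              (not_le.2 hω')
          refine pow_le_trace_pow (hSs ω) (by positivity) (v := v) ?_ p
          rw [hsum]
          exact hv
      _ ≤ _ := Finset.sum_le_sum_of_subset_of_nonneg (Finset.subset_univ _)
          fun ω _ _ => hnn ω
  -- `p (n R² / 2) ≤ (n t)² / 3`, and `1/3 ≤ 1/e`
  have hbase : (p : ℝ) * (n * (R ^ 2 / 2)) ≤ (n * t) ^ 2 * Real.exp (-1) := by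
    have he : (1 / 3 : ℝ) ≤ Real.exp (-1) := by
      rw [Real.exp_neg, one_div]
      exact inv_anti₀ (Real.exp_pos 1) (by linarith [Real.exp_one_lt_d9])
    have h1 : (p : ℝ) ≤ 4 / 3 * l := by linarith
    calc (p : ℝ) * (n * (R ^ 2 / 2)) ≤ 4 / 3 * l * (n * (R ^ 2 / 2)) :=
          mul_le_mul_of_nonneg_right h1 (by positivity)
      _ = n * (2 * R ^ 2 * l) * (1 / 3) := by ring
      _ ≤ n * (n * t ^ 2) * Real.exp (-1) := by gcongr
      _ = _ := by ring
  have hpow : ((p : ℝ) * (n * (R ^ 2 / 2))) ^ p ≤ (n * t) ^ (2 * p) * Real.exp (-l) := by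
    calc ((p : ℝ) * (n * (R ^ 2 / 2))) ^ p ≤ ((n * t) ^ 2 * Real.exp (-1)) ^ p :=
          pow_le_pow_left₀ (by positivity) hbase p
      _ = (n * t) ^ (2 * p) * Real.exp (-p) := by
          rw [mul_pow, ← pow_mul, ← Real.exp_nat_mul]; ring_nf
      _ ≤ _ := by gcongr
  have hpos : 0 < (n * t) ^ (2 * p) := by positivity
  refine le_of_mul_le_mul_right ?_ hpos
  calc (B.card : ℝ) * (n * t) ^ (2 * p) ≤ _ := hmarkov
    _ ≤ _ := hmom
    _ ≤ ((n * t) ^ (2 * p) * Real.exp (-l)) *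
        (Module.finrank ℝ E * Fintype.card (κ → α)) := by gcongr
    _ = _ := by ring

end Moments

/-! ### Tail bounds for batch means -/

theorem norm_sub_sub_sub_le {α V : Type*} [NormedAddCommGroup V] {h : α → V} {r : ℝ}
    (hr : ∀ a, ‖h a‖ ≤ r) (c : V) (a b : α) :
    ‖(h a - c) - (h b - c)‖ ≤ 2 * r := by
  rw [sub_sub_sub_cancel_right]
  linarith [norm_sub_le (h a) (h b), hr a, hr b]

section Dilation

variable {E : Type*} [NormedAddCommGroup E] [InnerProductSpace ℝ E] [FiniteDimensional ℝ E]

/-- The self-adjoint dilation of a vector `v`: the operator `(x, a) ↦ (a v, ⟪v, x⟫)` on `E ⊕ ℝ`.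
It is symmetric, depends linearly on `v`, and has operator norm `‖v‖`. -/
noncomputable def dilation :
    E →ₗ[ℝ] (WithLp 2 (E × ℝ) →L[ℝ] WithLp 2 (E × ℝ)) :=
  (LinearMap.toContinuousLinearMap (𝕜 := ℝ) (E := WithLp 2 (E × ℝ))
      (F' := WithLp 2 (E × ℝ))).toLinearMap ∘ₗ
    LinearMap.mk₂ ℝ (fun (v : E) (x : WithLp 2 (E × ℝ)) =>
        WithLp.toLp 2 (x.snd • v, ⟪v, x.fst⟫_ℝ))
      (fun _ _ _ => WithLp.ofLp_injective 2 (Prod.ext (smul_add _ _ _) (inner_add_left _ _ _)))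
      (fun _ _ _ => WithLp.ofLp_injective 2
        (Prod.ext (smul_comm _ _ _) (real_inner_smul_left _ _ _)))
      (fun _ _ _ => WithLp.ofLp_injective 2 (Prod.ext (add_smul _ _ _) (inner_add_right _ _ _)))
      (fun _ _ _ => WithLp.ofLp_injective 2
        (Prod.ext (mul_smul _ _ _) (real_inner_smul_right _ _ _)))

theorem dilation_apply (v : E) (x : WithLp 2 (E × ℝ)) :
    dilation v x = WithLp.toLp 2 (x.snd • v, ⟪v, x.fst⟫_ℝ) := rfl

theorem dilation_isSymmetric (v : E) :
    (dilation v : WithLp 2 (E × ℝ) →ₗ[ℝ] WithLp 2 (E × ℝ)).IsSymmetric := by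
  intro x y
  simp only [ContinuousLinearMap.coe_coe, dilation_apply, WithLp.prod_inner_apply]
  change ⟪x.snd • v, y.fst⟫_ℝ + y.snd * ⟪v, x.fst⟫_ℝ
    = ⟪x.fst, y.snd • v⟫_ℝ + ⟪v, y.fst⟫_ℝ * x.snd
  rw [real_inner_smul_left, real_inner_smul_right, real_inner_comm v x.fst]
  ring

theorem norm_dilation (v : E) : ‖dilation v‖ = ‖v‖ := by
  refine le_antisymm (ContinuousLinearMap.opNorm_le_bound _ (norm_nonneg _) fun x => ?_) ?_
  · refine le_of_sq_le_sq ?_ (by positivity)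
    rw [mul_pow, WithLp.prod_norm_sq_eq_of_L2, WithLp.prod_norm_sq_eq_of_L2, dilation_apply]
    have h1 : ‖x.snd • v‖ ^ 2 = ‖v‖ ^ 2 * ‖x.snd‖ ^ 2 := by rw [norm_smul]; ring
    have h2 : ‖⟪v, x.fst⟫_ℝ‖ ^ 2 ≤ ‖v‖ ^ 2 * ‖x.fst‖ ^ 2 := by
      rw [← mul_pow]
      exact pow_le_pow_left₀ (norm_nonneg _) (norm_inner_le_norm _ _) 2
    change ‖x.snd • v‖ ^ 2 + ‖⟪v, x.fst⟫_ℝ‖ ^ 2 ≤ _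
    linarith
  · have h := (dilation v).le_opNorm (WithLp.toLp 2 (0, 1))
    rw [dilation_apply] at h
    have e1 : ‖(WithLp.toLp 2 ((0 : E), (1 : ℝ)) : WithLp 2 (E × ℝ))‖ = 1 := by
      rw [WithLp.prod_norm_eq_of_L2]; simp
    have e2 : ‖(WithLp.toLp 2 (v, (0 : ℝ)) : WithLp 2 (E × ℝ))‖ = ‖v‖ := by
      rw [WithLp.prod_norm_eq_of_L2]; simp
    rw [e1] at h
    simpa [e2] using h

end Dilation

section Batch

variable {E : Type*} [NormedAddCommGroup E] [InnerProductSpace ℝ E] [FiniteDimensional ℝ E]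
  {α κ : Type*} [Fintype α] [Nonempty α] [Fintype κ] [DecidableEq κ]

/-- The vector analogue of `card_norm_sum_le`, by dilation. -/
theorem card_norm_sum_vec_le {A : α → E}
    (h0 : ∑ a, A a = 0) {R t l : ℝ} (hR : ∀ a b, ‖A a - A b‖ ≤ R) (ht : 0 < t) (hl : 3 ≤ l)
    (hκ : 0 < Fintype.card κ) (hn : 2 * R ^ 2 * l ≤ Fintype.card κ * t ^ 2) :
    (Nat.card {ω : κ → α // Fintype.card κ * t < ‖∑ i, A (ω i)‖} : ℝ)
      ≤ (Module.finrank ℝ E + 1) * Real.exp (-l) * Fintype.card (κ → α) := by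
  have h := card_norm_sum_le (κ := κ) (A := fun a => dilation (A a))
    (fun a => dilation_isSymmetric _) (by rw [← map_sum, h0, map_zero]) (R := R)
    (fun a b => by rw [← map_sub, norm_dilation]; exact hR a b) ht hl hκ hn
  have hd : Module.finrank ℝ (WithLp 2 (E × ℝ)) = Module.finrank ℝ E + 1 := by
    rw [(WithLp.linearEquiv 2 ℝ (E × ℝ)).finrank_eq, Module.finrank_prod, Module.finrank_self]
  simp only [← map_sum, norm_dilation, hd] at h
  exact_mod_cast h

section Center

variable {V : Type*} [NormedAddCommGroup V] [NormedSpace ℝ V]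

theorem sum_sub_mean (h : α → V) :
    ∑ a, (h a - (Fintype.card α : ℝ)⁻¹ • ∑ b, h b) = 0 := by
  have hN : (Fintype.card α : ℝ) ≠ 0 := by exact_mod_cast Fintype.card_ne_zero
  rw [Finset.sum_sub_distrib, Finset.sum_const, Finset.card_univ, ← Nat.cast_smul_eq_nsmul ℝ,
    smul_smul, mul_inv_cancel₀ hN, one_smul, sub_self]

theorem norm_sum_sub_mean {α κ : Type*} [Fintype α] [Fintype κ] (h : α → V)
    (hκ : 0 < Fintype.card κ) (ω : κ → α) :
    ‖∑ i, (h (ω i) - (Fintype.card α : ℝ)⁻¹ • ∑ b, h b)‖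
      = Fintype.card κ *
        ‖(Fintype.card κ : ℝ)⁻¹ • ∑ i, h (ω i) - (Fintype.card α : ℝ)⁻¹ • ∑ b, h b‖ := by
  have hn : (Fintype.card κ : ℝ) ≠ 0 := by exact_mod_cast hκ.ne'
  rw [Finset.sum_sub_distrib, Finset.sum_const, Finset.card_univ, ← Nat.cast_smul_eq_nsmul ℝ]
  rw [show ∀ v : V, (Fintype.card κ : ℝ) * ‖v‖ = ‖(Fintype.card κ : ℝ) • v‖ from fun v => by
    rw [norm_smul, Real.norm_natCast], smul_sub, smul_inv_smul₀ hn]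

end Center

/-- If `n t² ≥ 8 r² ℓ`, the mean of `n` uniform samples from symmetric operators of norm at most `r`
is within `t` of the mean of the family, for all but a fraction `d e^{-ℓ}` of the samples. -/
theorem card_mean_deviation_op_le {h : α → E →L[ℝ] E}
    (hs : ∀ a, (h a : E →ₗ[ℝ] E).IsSymmetric) {r t l : ℝ} (hr : ∀ a, ‖h a‖ ≤ r) (ht : 0 < t)
    (hl : 3 ≤ l) (hκ : 0 < Fintype.card κ) (hn : 8 * r ^ 2 * l ≤ Fintype.card κ * t ^ 2) :
    (Nat.card {ω : κ → α // t <
        ‖(Fintype.card κ : ℝ)⁻¹ • ∑ i, h (ω i) - (Fintype.card α : ℝ)⁻¹ • ∑ b, h b‖} : ℝ)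
      ≤ Module.finrank ℝ E * Real.exp (-l) * Fintype.card (κ → α) := by
  have hn0 : (0 : ℝ) < Fintype.card κ := by exact_mod_cast hκ
  have hsum : (((∑ b, h b : E →L[ℝ] E)) : E →ₗ[ℝ] E).IsSymmetric := by
    have := isSymmetric_sum (A := fun a => (h a : E →ₗ[ℝ] E)) hs Finset.univ
    convert this using 1
    simp
  have := card_norm_sum_le (κ := κ)
    (A := fun a => h a - (Fintype.card α : ℝ)⁻¹ • ∑ b, h b)
    (fun a => (hs a).sub (hsum.smul (by simp)))
    (sum_sub_mean h) (norm_sub_sub_sub_le hr _) ht hl hκ (by linarith)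
  simpa only [norm_sum_sub_mean h hκ, mul_lt_mul_iff_right₀ hn0] using this

theorem card_mean_deviation_vec_le {h : α → E} {r t l : ℝ} (hr : ∀ a, ‖h a‖ ≤ r) (ht : 0 < t)
    (hl : 3 ≤ l) (hκ : 0 < Fintype.card κ) (hn : 8 * r ^ 2 * l ≤ Fintype.card κ * t ^ 2) :
    (Nat.card {ω : κ → α // t <
        ‖(Fintype.card κ : ℝ)⁻¹ • ∑ i, h (ω i) - (Fintype.card α : ℝ)⁻¹ • ∑ b, h b‖} : ℝ)
      ≤ (Module.finrank ℝ E + 1) * Real.exp (-l) * Fintype.card (κ → α) := by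
  have hn0 : (0 : ℝ) < Fintype.card κ := by exact_mod_cast hκ
  have := card_norm_sum_vec_le (κ := κ)
    (A := fun a => h a - (Fintype.card α : ℝ)⁻¹ • ∑ b, h b)
    (sum_sub_mean h) (norm_sub_sub_sub_le hr _) ht hl hκ (by linarith)
  simpa only [norm_sum_sub_mean h hκ, mul_lt_mul_iff_right₀ hn0] using this

end Batch

/-! ### Gradients and Hessians -/

section Calculus

variable {d : ℕ} {h : Vec d → ℝ}

theorem gradient_eq_toDual_symm_comp :
    gradient h = (InnerProductSpace.toDual ℝ (Vec d)).symm ∘ fderiv ℝ h := rfl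

theorem contDiff_gradient (hh : ContDiff ℝ 2 h) : ContDiff ℝ 1 (gradient h) := by
  rw [gradient_eq_toDual_symm_comp]
  exact (InnerProductSpace.toDual ℝ (Vec d)).symm.toContinuousLinearEquiv.contDiff.comp
    (hh.fderiv_right (m := 1) (by norm_num))

theorem hasFDerivAt_gradient (hh : ContDiff ℝ 2 h) (x : Vec d) :
    HasFDerivAt (gradient h) (hessian h x) x :=
  ((contDiff_gradient hh).differentiable (by norm_num) x).hasFDerivAt

theorem fderiv_apply_eq_inner_gradient (x v : Vec d) :
    fderiv ℝ h x v = ⟪gradient h x, v⟫_ℝ := by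
  rw [gradient, InnerProductSpace.toDual_symm_apply]

theorem inner_hessian_eq (hh : ContDiff ℝ 2 h) (x v w : Vec d) :
    ⟪hessian h x v, w⟫_ℝ = fderiv ℝ (fderiv ℝ h) x v w := by
  have h1 : HasFDerivAt (fderiv ℝ h) (fderiv ℝ (fderiv ℝ h) x) x :=
    (((hh.fderiv_right (m := 1) (by norm_num)).differentiable (by norm_num)) x).hasFDerivAt
  have h2 := ((InnerProductSpace.toDual ℝ (Vec d)).symm.toContinuousLinearEquiv.hasFDerivAt
    (x := fderiv ℝ h x)).comp x h1
  have h3 := h2.unique (hasFDerivAt_gradient hh x)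
  rw [← h3]
  exact InnerProductSpace.toDual_symm_apply

theorem hessian_isSelfAdjoint (hh : ContDiff ℝ 2 h) (x : Vec d) : IsSelfAdjoint (hessian h x) := by
  rw [ContinuousLinearMap.isSelfAdjoint_iff_isSymmetric]
  intro v w
  change ⟪hessian h x v, w⟫_ℝ = ⟪v, hessian h x w⟫_ℝ
  rw [real_inner_comm (hessian h x w) v, inner_hessian_eq hh, inner_hessian_eq hh]
  exact (hh.contDiffAt.isSymmSndFDerivAt (by simp)).eq v w

theorem hasDerivAt_gradient_segment (hh : ContDiff ℝ 2 h) (x s : Vec d) (t : ℝ) :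
    HasDerivAt (fun t : ℝ => gradient h (x + t • s)) (hessian h (x + t • s) s) t := by
  have h1 : HasDerivAt (fun t : ℝ => x + t • s) s t := by
    simpa using ((hasDerivAt_id t).smul_const s).const_add x
  exact (hasFDerivAt_gradient hh (x + t • s)).comp_hasDerivAt t h1

theorem hasDerivAt_segment (hh : ContDiff ℝ 2 h) (x s : Vec d) (t : ℝ) :
    HasDerivAt (fun t : ℝ => h (x + t • s)) ⟪gradient h (x + t • s), s⟫_ℝ t := by
  have h1 : HasDerivAt (fun t : ℝ => x + t • s) s t := by
    simpa using ((hasDerivAt_id t).smul_const s).const_add x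
  have h2 := ((hh.differentiable (by norm_num)) (x + t • s)).hasFDerivAt.comp_hasDerivAt t h1
  rwa [fderiv_apply_eq_inner_gradient] at h2

variable {L : ℝ≥0}

theorem norm_gradient_taylor_segment_le (hh : ContDiff ℝ 2 h) (hL : LipschitzWith L (hessian h))
    (x s : Vec d) {t : ℝ} (ht : t ∈ Set.Icc (0 : ℝ) 1) :
    ‖gradient h (x + t • s) - gradient h x - t • hessian h x s‖ ≤ L * ‖s‖ ^ 2 * (t ^ 2 / 2) := by
  have hd : ∀ t : ℝ, HasDerivAt
      (fun t : ℝ => gradient h (x + t • s) - gradient h x - t • hessian h x s)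
      (hessian h (x + t • s) s - hessian h x s) t := fun t =>
    (((hasDerivAt_gradient_segment hh x s t).sub_const (gradient h x)).fun_sub
      ((hasDerivAt_id' t).smul_const (hessian h x s))).congr_deriv (by rw [one_smul])
  have hB : ∀ t : ℝ, HasDerivAt (fun t : ℝ => L * ‖s‖ ^ 2 * (t ^ 2 / 2)) (L * ‖s‖ ^ 2 * t) t :=
    fun t => (((hasDerivAt_pow 2 t).div_const 2).const_mul ((L : ℝ) * ‖s‖ ^ 2)).congr_deriv
      (by norm_num)
  refine image_norm_le_of_norm_deriv_right_le_deriv_boundary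
    (fun t _ => (hd t).continuousAt.continuousWithinAt)
    (fun t _ => (hd t).hasDerivWithinAt) (by simp) hB (fun t ht => ?_) ht
  rw [← sub_apply]
  calc _ ≤ ‖hessian h (x + t • s) - hessian h x‖ * ‖s‖ := ContinuousLinearMap.le_opNorm _ _
    _ ≤ (L * ‖x + t • s - x‖) * ‖s‖ := by gcongr; exact hL.norm_sub_le _ _
    _ = _ := by
      rw [add_sub_cancel_left, norm_smul, Real.norm_of_nonneg ht.1]; ring

theorem norm_gradient_taylor_le (hh : ContDiff ℝ 2 h) (hL : LipschitzWith L (hessian h))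
    (x s : Vec d) :
    ‖gradient h (x + s) - gradient h x - hessian h x s‖ ≤ L / 2 * ‖s‖ ^ 2 := by
  have := norm_gradient_taylor_segment_le hh hL x s (t := 1) (by simp)
  simp only [one_smul] at this
  linarith

theorem taylor_upper_bound (hh : ContDiff ℝ 2 h) (hL : LipschitzWith L (hessian h))
    (x s : Vec d) :
    h (x + s) ≤ h x + ⟪gradient h x, s⟫_ℝ + 1 / 2 * ⟪s, hessian h x s⟫_ℝ + L / 6 * ‖s‖ ^ 3 := by
  have hd : ∀ t : ℝ, HasDerivAt
      (fun t : ℝ => h (x + t • s) - t * ⟪gradient h x, s⟫_ℝ - t ^ 2 / 2 * ⟪hessian h x s, s⟫_ℝ)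
      (⟪gradient h (x + t • s) - gradient h x - t • hessian h x s, s⟫_ℝ) t := fun t =>
    (((hasDerivAt_segment hh x s t).fun_sub
      ((hasDerivAt_id' t).mul_const ⟪gradient h x, s⟫_ℝ)).fun_sub
      (((hasDerivAt_pow 2 t).div_const 2).mul_const ⟪hessian h x s, s⟫_ℝ)).congr_deriv (by
        rw [inner_sub_left, inner_sub_left, real_inner_smul_left]
        norm_num)
  have hB : ∀ t : ℝ, HasDerivAt (fun t : ℝ => h x + L * ‖s‖ ^ 3 * (t ^ 3 / 6))
      (L * ‖s‖ ^ 3 * (t ^ 2 / 2)) t := fun t =>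
    ((((hasDerivAt_pow 3 t).div_const 6).const_mul ((L : ℝ) * ‖s‖ ^ 3)).const_add
      (h x)).congr_deriv (by simp only [Nat.cast_ofNat, Nat.reduceSub]; ring)
  have := image_le_of_deriv_right_le_deriv_boundary (a := 0) (b := 1)
    (fun t _ => (hd t).continuousAt.continuousWithinAt)
    (fun t _ => (hd t).hasDerivWithinAt) (by simp)
    (fun t _ => (hB t).continuousAt.continuousWithinAt)
    (fun t _ => (hB t).hasDerivWithinAt) (fun t ht => ?_) (x := 1) (by simp)
  · simp only [one_smul] at this
    rw [real_inner_comm (hessian h x s)]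
    linarith
  · calc _ ≤ ‖gradient h (x + t • s) - gradient h x - t • hessian h x s‖ * ‖s‖ :=
        real_inner_le_norm _ _
      _ ≤ (L * ‖s‖ ^ 2 * (t ^ 2 / 2)) * ‖s‖ := by
        gcongr; exact norm_gradient_taylor_segment_le hh hL x s ⟨ht.1, ht.2.le⟩
      _ = _ := by ring

end Calculus

section Objective

variable {d N : ℕ} {f : Fin N → Vec d → ℝ}

theorem contDiff_objective (hf : ∀ i, ContDiff ℝ 2 (f i)) : ContDiff ℝ 2 (objective f) :=
  contDiff_const.mul (ContDiff.sum fun i _ => hf i)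

theorem gradient_objective (hf : ∀ i, ContDiff ℝ 2 (f i)) (x : Vec d) :
    gradient (objective f) x = (N : ℝ)⁻¹ • ∑ i, gradient (f i) x := by
  have h1 : HasFDerivAt (objective f) ((N : ℝ)⁻¹ • ∑ i, fderiv ℝ (f i) x) x :=
    (HasFDerivAt.fun_sum fun i _ =>
      ((hf i).differentiable (by norm_num) x).hasFDerivAt).const_mul _
  rw [gradient, h1.fderiv]
  simp [gradient]

theorem hessian_objective (hf : ∀ i, ContDiff ℝ 2 (f i)) (x : Vec d) :
    hessian (objective f) x = (N : ℝ)⁻¹ • ∑ i, hessian (f i) x := by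
  have h0 : gradient (objective f) = fun x => (N : ℝ)⁻¹ • ∑ i, gradient (f i) x :=
    funext (gradient_objective hf)
  rw [hessian, h0]
  exact ((HasFDerivAt.fun_sum fun i _ => hasFDerivAt_gradient (hf i) x).const_smul (N : ℝ)⁻¹).fderiv

theorem lipschitzWith_hessian_objective (hN : 0 < N) (hf : ∀ i, ContDiff ℝ 2 (f i)) {L : ℝ≥0}
    (hL : ∀ i, LipschitzWith L (hessian (f i))) : LipschitzWith L (hessian (objective f)) := by
  have hN' : (0 : ℝ) < N := by exact_mod_cast hN
  refine LipschitzWith.of_dist_le_mul fun x y => ?_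
  have e : hessian (objective f) x - hessian (objective f) y
      = (N : ℝ)⁻¹ • ∑ i, (hessian (f i) x - hessian (f i) y) := by
    rw [hessian_objective hf, hessian_objective hf, Finset.sum_sub_distrib]
    exact (smul_sub _ _ _).symm
  rw [dist_eq_norm, e, norm_smul, norm_inv, Real.norm_natCast]
  calc (N : ℝ)⁻¹ * ‖∑ i, (hessian (f i) x - hessian (f i) y)‖
      ≤ (N : ℝ)⁻¹ * ∑ i : Fin N, (L : ℝ) * dist x y := by
        gcongr
        exact norm_sum_le_of_le _ fun i _ => by
          rw [← dist_eq_norm]; exact (hL i).dist_le_mul x y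
    _ = _ := by
      rw [Finset.sum_const, Finset.card_univ, Fintype.card_fin, nsmul_eq_mul]
      field_simp

end Objective

/-! ### Global minimizers of the cubic model -/

section Cubic

variable {d : ℕ} {M : ℝ} {g s : Vec d} {H : Op d}

theorem inner_apply_comm_of_isSelfAdjoint (hH : IsSelfAdjoint H) (v w : Vec d) :
    ⟪v, H w⟫_ℝ = ⟪w, H v⟫_ℝ := by
  rw [ContinuousLinearMap.isSelfAdjoint_iff_isSymmetric] at hH
  rw [← real_inner_comm]
  exact hH w v

theorem cubicModel_first_order (hH : IsSelfAdjoint H)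
    (hmin : ∀ u, cubicModel M g H s ≤ cubicModel M g H u) :
    g + H s + (M / 2 * ‖s‖) • s = 0 := by
  have h1 : HasFDerivAt (fun u : Vec d => ⟪g, u⟫_ℝ) (innerSL ℝ g) s :=
    (innerSL ℝ g).hasFDerivAt
  have h2 := (hasFDerivAt_id s).inner ℝ (H.hasFDerivAt (x := s))
  have h3 : HasFDerivAt (fun u : Vec d => ‖u‖ ^ 3) (((3 : ℝ) * ‖s‖) • innerSL ℝ s) s := by
    have := hasFDerivAt_norm_rpow s (p := 3) (by norm_num)
    rw [show (3 : ℝ) - 2 = 1 by norm_num, Real.rpow_one] at this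
    refine this.congr_of_eventuallyEq (Filter.Eventually.of_forall fun u => ?_)
    exact (Real.rpow_natCast ‖u‖ 3).symm
  have h4 := (h1.add (h2.const_mul (1 / 2))).add (h3.const_mul (M / 6))
  have hloc : IsLocalMin (cubicModel M g H) s := Filter.Eventually.of_forall hmin
  have h5 := hloc.hasFDerivAt_eq_zero h4
  set w := g + H s + (M / 2 * ‖s‖) • s with hw
  have h6 := DFunLike.congr_fun h5 w
  have h7 : ⟪g, w⟫_ℝ + 1 / 2 * (⟪s, H w⟫_ℝ + ⟪w, H s⟫_ℝ)
      + M / 6 * (3 * ‖s‖ * ⟪s, w⟫_ℝ) = 0 := by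
    simpa [fderivInnerCLM_apply] using h6
  rw [inner_apply_comm_of_isSelfAdjoint hH s w, real_inner_comm (H s) w] at h7
  have h8 : ⟪w, w⟫_ℝ = 0 := by
    nth_rewrite 1 [hw]
    rw [inner_add_left, inner_add_left, real_inner_smul_left]
    linarith
  exact inner_self_eq_zero.1 h8

theorem cubicModel_add_sub (hH : IsSelfAdjoint H) (w : Vec d) :
    cubicModel M g H (s + w) - cubicModel M g H s
      = ⟪g + H s, w⟫_ℝ + 1 / 2 * ⟪w, H w⟫_ℝ + M / 6 * (‖s + w‖ ^ 3 - ‖s‖ ^ 3) := by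
  simp only [cubicModel, map_add, inner_add_left, inner_add_right]
  rw [inner_apply_comm_of_isSelfAdjoint hH s w, real_inner_comm (H s) w]
  ring

/-- Reflecting `s` in the hyperplane orthogonal to `v` keeps its norm, and so compares the quadratic
parts alone. -/
theorem cubicModel_second_order_of_inner_ne_zero (hH : IsSelfAdjoint H)
    (hmin : ∀ u, cubicModel M g H s ≤ cubicModel M g H u) {v : Vec d} (hv : ⟪s, v⟫_ℝ ≠ 0) :
    0 ≤ ⟪v, H v⟫_ℝ + M / 2 * ‖s‖ * ‖v‖ ^ 2 := by
  have hv0 : v ≠ 0 := by rintro rfl; simp at hv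
  have hvn : ‖v‖ ^ 2 ≠ 0 := pow_ne_zero 2 (norm_ne_zero_iff.2 hv0)
  set c : ℝ := -(2 * ⟪s, v⟫_ℝ / ‖v‖ ^ 2) with hc
  have hc0 : c ≠ 0 := by
    rw [hc]; exact neg_ne_zero.2 (div_ne_zero (mul_ne_zero two_ne_zero hv) hvn)
  have hsw : 2 * (c * ⟪s, v⟫_ℝ) + c ^ 2 * ‖v‖ ^ 2 = 0 := by rw [hc]; field_simp; ring
  have hnorm : ‖s + c • v‖ = ‖s‖ := by
    have : ‖s + c • v‖ ^ 2 = ‖s‖ ^ 2 := by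
      rw [norm_add_sq_real, real_inner_smul_right, norm_smul, mul_pow, Real.norm_eq_abs, sq_abs]
      linarith
    exact (pow_left_inj₀ (norm_nonneg _) (norm_nonneg _) two_ne_zero).1 this
  have h1 := cubicModel_add_sub (M := M) (g := g) (s := s) hH (c • v)
  have h2 := hmin (s + c • v)
  have h3 : g + H s = -((M / 2 * ‖s‖) • s) :=
    eq_neg_of_add_eq_zero_left (cubicModel_first_order hH hmin)
  rw [hnorm, h3, inner_neg_left, real_inner_smul_left, real_inner_smul_right, map_smul,
    real_inner_smul_left, real_inner_smul_right] at h1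
  have h4 : 0 ≤ c ^ 2 * (⟪v, H v⟫_ℝ + M / 2 * ‖s‖ * ‖v‖ ^ 2) := by
    have : c * ⟪s, v⟫_ℝ = -(c ^ 2 * ‖v‖ ^ 2) / 2 := by linarith
    rw [this] at h1
    linarith
  exact nonneg_of_mul_nonneg_right h4 (by positivity)

theorem cubicModel_second_order (hH : IsSelfAdjoint H)
    (hmin : ∀ u, cubicModel M g H s ≤ cubicModel M g H u) (v : Vec d) :
    0 ≤ ⟪v, H v⟫_ℝ + M / 2 * ‖s‖ * ‖v‖ ^ 2 := by
  by_cases hv : ⟪s, v⟫_ℝ = 0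
  swap
  · exact cubicModel_second_order_of_inner_ne_zero hH hmin hv
  by_cases hs : s = 0
  · -- here `g = 0`, and the model along `t v` is `t² / 2 ⟪v, H v⟫ + O(t³)`
    have hg : g = 0 := by simpa [hs] using cubicModel_first_order hH hmin
    have hlim : Filter.Tendsto (fun t : ℝ => ⟪v, H v⟫_ℝ + M / 3 * ‖v‖ ^ 3 * t)
        (nhdsWithin 0 (Set.Ioi 0)) (nhds (⟪v, H v⟫_ℝ + M / 2 * ‖s‖ * ‖v‖ ^ 2)) := by
      have : Continuous (fun t : ℝ => ⟪v, H v⟫_ℝ + M / 3 * ‖v‖ ^ 3 * t) := by fun_prop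
      convert (this.tendsto 0).mono_left nhdsWithin_le_nhds using 2
      simp [hs]
    refine ge_of_tendsto hlim ?_
    filter_upwards [self_mem_nhdsWithin] with t ht
    have ht' : (0 : ℝ) < t := ht
    have h1 := cubicModel_add_sub (M := M) (g := g) (s := s) hH (t • v)
    have h2 := hmin (s + t • v)
    rw [hs, hg, map_zero, add_zero, zero_add, inner_zero_left, map_smul, real_inner_smul_left,
      real_inner_smul_right, norm_smul, Real.norm_of_nonneg ht'.le, norm_zero] at h1
    rw [hs, hg, zero_add] at h2
    have h3 : 0 ≤ t ^ 2 * (⟪v, H v⟫_ℝ + M / 3 * ‖v‖ ^ 3 * t) := by linarith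
    exact nonneg_of_mul_nonneg_right h3 (by positivity)
  · have hlim : Filter.Tendsto
        (fun t : ℝ => ⟪v + t • s, H (v + t • s)⟫_ℝ + M / 2 * ‖s‖ * ‖v + t • s‖ ^ 2)
        (nhdsWithin 0 {0}ᶜ) (nhds (⟪v, H v⟫_ℝ + M / 2 * ‖s‖ * ‖v‖ ^ 2)) := by
      have : Continuous
          (fun t : ℝ => ⟪v + t • s, H (v + t • s)⟫_ℝ + M / 2 * ‖s‖ * ‖v + t • s‖ ^ 2) := by
        fun_prop
      convert (this.tendsto 0).mono_left nhdsWithin_le_nhds using 2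
      simp
    refine ge_of_tendsto hlim ?_
    filter_upwards [self_mem_nhdsWithin] with t ht
    refine cubicModel_second_order_of_inner_ne_zero hH hmin ?_
    rw [inner_add_right, hv, zero_add, real_inner_smul_right, real_inner_self_eq_norm_sq]
    exact mul_ne_zero ht (pow_ne_zero 2 (norm_ne_zero_iff.2 hs))

/-- A global minimizer decreases the model by `M / 12 ‖s‖³`: the first-order condition gives
`2 m(s) = ⟪g, s⟫ - M / 6 ‖s‖³`, and comparison with `-s` gives `⟪g, s⟫ ≤ 0`. -/
theorem cubicModel_le (hH : IsSelfAdjoint H)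
    (hmin : ∀ u, cubicModel M g H s ≤ cubicModel M g H u) :
    cubicModel M g H s ≤ -(M / 12) * ‖s‖ ^ 3 := by
  have h1 : ⟪g, s⟫_ℝ ≤ 0 := by
    have := hmin (-s)
    simp only [cubicModel, inner_neg_right, map_neg, inner_neg_left, neg_neg, norm_neg] at this
    linarith
  have h2 : ⟪g, s⟫_ℝ + ⟪s, H s⟫_ℝ + M / 2 * ‖s‖ ^ 3 = 0 := by
    have := congrArg (fun w => ⟪w, s⟫_ℝ) (cubicModel_first_order hH hmin)
    simp only [inner_add_left, real_inner_smul_left, inner_zero_left,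
      real_inner_self_eq_norm_sq] at this
    rw [real_inner_comm (H s) s]
    linarith
  rw [cubicModel]
  linarith

end Cubic

/-! ### One iteration with inexact derivatives -/

section Step

variable {d : ℕ} {F : Vec d → ℝ} {L : ℝ≥0} {M a b : ℝ} {g x s : Vec d} {H : Op d}

theorem descent (hF : ContDiff ℝ 2 F) (hL : LipschitzWith L (hessian F)) (hH : IsSelfAdjoint H)
    (hmin : ∀ u, cubicModel M g H s ≤ cubicModel M g H u)
    (hg : ‖g - gradient F x‖ ≤ b) (hHe : ‖H - hessian F x‖ ≤ a) :
    F (x + s) ≤ F x - (3 * M - 2 * L) / 12 * ‖s‖ ^ 3 + b * ‖s‖ + 1 / 2 * a * ‖s‖ ^ 2 := by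
  have h1 := taylor_upper_bound hF hL x s
  have h2 := cubicModel_le hH hmin
  rw [cubicModel] at h2
  have h3 : ⟪gradient F x, s⟫_ℝ ≤ ⟪g, s⟫_ℝ + b * ‖s‖ := by
    have e : ⟪gradient F x - g, s⟫_ℝ ≤ b * ‖s‖ :=
      (real_inner_le_norm _ _).trans (mul_le_mul_of_nonneg_right (by rwa [norm_sub_rev])
        (norm_nonneg _))
    rw [inner_sub_left] at e
    linarith
  have h4 : ⟪s, hessian F x s⟫_ℝ ≤ ⟪s, H s⟫_ℝ + a * ‖s‖ ^ 2 := by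
    have e : ⟪s, (hessian F x - H) s⟫_ℝ ≤ a * ‖s‖ ^ 2 := by
      calc _ ≤ ‖s‖ * ‖(hessian F x - H) s‖ := real_inner_le_norm _ _
        _ ≤ ‖s‖ * (a * ‖s‖) := by
          gcongr
          exact ((hessian F x - H).le_opNorm s).trans
            (mul_le_mul_of_nonneg_right (by rwa [norm_sub_rev]) (norm_nonneg _))
        _ = _ := by ring
    rw [sub_apply, inner_sub_right] at e
    linarith
  linarith

theorem norm_gradient_step_le (hF : ContDiff ℝ 2 F) (hL : LipschitzWith L (hessian F))
    (hM : 0 < M) (hH : IsSelfAdjoint H)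
    (hmin : ∀ u, cubicModel M g H s ≤ cubicModel M g H u)
    (hg : ‖g - gradient F x‖ ≤ b) (hHe : ‖H - hessian F x‖ ≤ a) :
    ‖gradient F (x + s)‖ ≤ (L + M) / 2 * ‖s‖ ^ 2 + b + a * ‖s‖ := by
  have h1 := norm_gradient_taylor_le hF hL x s
  have h2 : ‖g + H s‖ ≤ M / 2 * ‖s‖ ^ 2 := by
    rw [eq_neg_of_add_eq_zero_left (cubicModel_first_order hH hmin), norm_neg, norm_smul,
      Real.norm_of_nonneg (by positivity)]
    exact le_of_eq (by ring)
  have h3 : ‖(H - hessian F x) s‖ ≤ a * ‖s‖ :=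
    (ContinuousLinearMap.le_opNorm _ s).trans (mul_le_mul_of_nonneg_right hHe (norm_nonneg _))
  have e : gradient F (x + s) = (gradient F (x + s) - gradient F x - hessian F x s)
      + (g + H s) - (g - gradient F x) - (H - hessian F x) s := by
    rw [sub_apply]; abel
  rw [e]
  refine (norm_sub_le _ _).trans ?_
  have h4 := norm_sub_le ((gradient F (x + s) - gradient F x - hessian F x s) + (g + H s))
    (g - gradient F x)
  have h5 := norm_add_le (gradient F (x + s) - gradient F x - hessian F x s) (g + H s)
  linarith

theorem curvature_step (hL : LipschitzWith L (hessian F)) (hH : IsSelfAdjoint H)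
    (hmin : ∀ u, cubicModel M g H s ≤ cubicModel M g H u)
    (hHe : ‖H - hessian F x‖ ≤ a) {t : ℝ} (ht : (M + 2 * L) / 2 * ‖s‖ + a ≤ t) :
    CurvatureAtLeastNeg (hessian F (x + s)) t := by
  intro v
  have h1 := cubicModel_second_order hH hmin v
  have h2 : ‖H - hessian F (x + s)‖ ≤ a + L * ‖s‖ := by
    have e : H - hessian F (x + s) = (H - hessian F x) - (hessian F (x + s) - hessian F x) := by
      abel
    rw [e]
    refine (norm_sub_le _ _).trans (add_le_add hHe ?_)
    simpa using hL.norm_sub_le (x + s) x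
  have h3 : ⟪v, (H - hessian F (x + s)) v⟫_ℝ ≤ (a + L * ‖s‖) * ‖v‖ ^ 2 := by
    calc _ ≤ ‖v‖ * ‖(H - hessian F (x + s)) v‖ := real_inner_le_norm _ _
      _ ≤ ‖v‖ * ((a + L * ‖s‖) * ‖v‖) := by
        gcongr
        exact (ContinuousLinearMap.le_opNorm _ v).trans
          (mul_le_mul_of_nonneg_right h2 (norm_nonneg _))
      _ = _ := by ring
  rw [sub_apply, inner_sub_right] at h3
  have h4 := mul_le_mul_of_nonneg_right ht (sq_nonneg ‖v‖)
  linarith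

end Step

/-! ### Summing the descent, and the drift from the snapshot -/

section Sequences

/-- Telescoping the descent while the stopping test fails: the test failing means
`e³ ≤ s_k³ + s_{k+1}³`, so that the estimation errors are absorbed by the cubic decrease. -/
theorem sum_cube_le {Fv s : ℕ → ℝ} {A w e D : ℝ} (hw : 0 ≤ w) (hs : ∀ k, 0 ≤ s k) (he : 0 ≤ e)
    (hs0 : s 0 = e) {n : ℕ}
    (hdesc : ∀ k < n, Fv (k + 1) ≤ Fv k - A * s (k + 1) ^ 3
      + w * (s k ^ 3 + s (k + 1) ^ 3 + e ^ 3))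
    (hlow : Fv 0 - D ≤ Fv n) (hns : ∀ k < n, e < max (s (k + 1)) (s k)) :
    (A - 4 * w) * ∑ k ∈ Finset.range n, s (k + 1) ^ 3 ≤ D + 2 * w * e ^ 3 := by
  have key : Fv n + (A - 4 * w) * ∑ k ∈ Finset.range n, s (k + 1) ^ 3 + 2 * w * s n ^ 3
      ≤ Fv 0 + 2 * w * e ^ 3 := by
    clear hlow
    induction n with
    | zero => simp [hs0]
    | succ n ih =>
      have ih := ih (fun k hk => hdesc k (hk.trans n.lt_succ_self))
        (fun k hk => hns k (hk.trans n.lt_succ_self))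
      have h1 := hdesc n n.lt_succ_self
      have h2 : e ^ 3 ≤ s n ^ 3 + s (n + 1) ^ 3 := by
        have p1 : 0 ≤ s n ^ 3 := pow_nonneg (hs n) 3
        have p2 : 0 ≤ s (n + 1) ^ 3 := pow_nonneg (hs (n + 1)) 3
        rcases lt_max_iff.1 (hns n n.lt_succ_self) with h | h
        · linarith [pow_le_pow_left₀ he h.le 3]
        · linarith [pow_le_pow_left₀ he h.le 3]
      have h3 := mul_le_mul_of_nonneg_left h2 hw
      rw [Finset.sum_range_succ]
      linarith
  have : 0 ≤ 2 * w * s n ^ 3 := by have := pow_nonneg (hs n) 3; positivity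
  linarith

theorem mul_cube_le_of_forall_lt {s : ℕ → ℝ} {e : ℝ} (hs : ∀ k, 0 ≤ s k) (he : 0 ≤ e)
    (hs0 : s 0 = e) {n : ℕ} (hns : ∀ k < n, e < max (s (k + 1)) (s k)) :
    n * e ^ 3 ≤ 2 * ∑ k ∈ Finset.range n, s (k + 1) ^ 3 + e ^ 3 := by
  have key : n * e ^ 3 + s n ^ 3 ≤ 2 * ∑ k ∈ Finset.range n, s (k + 1) ^ 3 + e ^ 3 := by
    induction n with
    | zero => simp [hs0]
    | succ n ih =>
      have ih := ih (fun k hk => hns k (hk.trans n.lt_succ_self))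
      have h2 : e ^ 3 ≤ s n ^ 3 + s (n + 1) ^ 3 := by
        have p1 : 0 ≤ s n ^ 3 := pow_nonneg (hs n) 3
        have p2 : 0 ≤ s (n + 1) ^ 3 := pow_nonneg (hs (n + 1)) 3
        rcases lt_max_iff.1 (hns n n.lt_succ_self) with h | h
        · linarith [pow_le_pow_left₀ he h.le 3]
        · linarith [pow_le_pow_left₀ he h.le 3]
      rw [Finset.sum_range_succ]
      push_cast
      linarith
  linarith [pow_nonneg (hs n) 3]

variable {r s : ℕ → ℝ} {m : ℕ}

theorem drift_le_sum (hr0 : ∀ k, k % m = 0 → r k = 0)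
    (hr : ∀ k, (k + 1) % m ≠ 0 → r (k + 1) ≤ r k + s (k + 1)) (k : ℕ) :
    r k ≤ ∑ j ∈ Finset.Ioc (k - k % m) k, s j := by
  induction k with
  | zero => simp [hr0 0 (Nat.zero_mod m)]
  | succ k ih =>
    by_cases h : (k + 1) % m = 0
    · simp [hr0 _ h, h]
    · have hm : (k + 1) % m = k % m + 1 := by
        rcases Nat.eq_zero_or_pos m with rfl | hm0
        · simp
        · rw [Nat.add_mod_eq_ite] at h ⊢
          rcases Nat.lt_or_ge 1 m with h1 | h1
          · rw [Nat.mod_eq_of_lt h1] at h ⊢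
            have := Nat.mod_lt k hm0
            split_ifs at h ⊢ <;> omega
          · obtain rfl : m = 1 := by omega
            simp [Nat.mod_one] at h
      have e : k + 1 - (k + 1) % m = k - k % m := by omega
      rw [e, Finset.sum_Ioc_succ_top (by omega)]
      linarith [hr k h]

/-- Each step enters the drift of at most `m` iterations, and each drift has at most `m` steps. -/
theorem sum_sq_drift_le (hm : 0 < m) (hrnn : ∀ k, 0 ≤ r k) (hr0 : ∀ k, k % m = 0 → r k = 0)
    (hr : ∀ k, (k + 1) % m ≠ 0 → r (k + 1) ≤ r k + s (k + 1)) (K : ℕ) :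
    ∑ k ∈ Finset.Icc 1 K, r k ^ 2 ≤ (m : ℝ) ^ 2 * ∑ j ∈ Finset.Icc 1 K, s j ^ 2 := by
  have h1 : ∀ k ∈ Finset.Icc 1 K,
      r k ^ 2 ≤ m * ∑ j ∈ Finset.Icc 1 K, if j ≤ k ∧ k < j + m then s j ^ 2 else 0 := by
    intro k hk
    have hk' := Finset.mem_Icc.1 hk
    have hmod := Nat.mod_lt k hm
    have hmodle := Nat.mod_le k m
    calc r k ^ 2 ≤ (∑ j ∈ Finset.Ioc (k - k % m) k, s j) ^ 2 :=
          pow_le_pow_left₀ (hrnn k) (drift_le_sum hr0 hr k) 2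
      _ ≤ (Finset.Ioc (k - k % m) k).card * ∑ j ∈ Finset.Ioc (k - k % m) k, s j ^ 2 :=
          sq_sum_le_card_mul_sum_sq
      _ ≤ m * ∑ j ∈ Finset.Icc 1 K, if j ≤ k ∧ k < j + m then s j ^ 2 else 0 := by
          have hcard : ((Finset.Ioc (k - k % m) k).card : ℝ) ≤ m := by
            rw [Nat.card_Ioc]; exact_mod_cast (by omega : k - (k - k % m) ≤ m)
          refine mul_le_mul hcard ?_ (Finset.sum_nonneg fun j _ => sq_nonneg _) (by positivity)
          rw [← Finset.sum_filter]
          refine Finset.sum_le_sum_of_subset_of_nonneg (fun j hj => ?_)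
            fun j _ _ => sq_nonneg _
          have := Finset.mem_Ioc.1 hj
          rw [Finset.mem_filter, Finset.mem_Icc]
          omega
  calc ∑ k ∈ Finset.Icc 1 K, r k ^ 2
      ≤ ∑ k ∈ Finset.Icc 1 K,
          m * ∑ j ∈ Finset.Icc 1 K, (if j ≤ k ∧ k < j + m then s j ^ 2 else 0) :=
        Finset.sum_le_sum h1
    _ = m * ∑ j ∈ Finset.Icc 1 K,
          ((Finset.Icc 1 K).filter (fun k => j ≤ k ∧ k < j + m)).card * s j ^ 2 := by
        rw [← Finset.mul_sum, Finset.sum_comm]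
        congr 1
        refine Finset.sum_congr rfl fun j _ => ?_
        rw [← Finset.sum_filter, Finset.sum_const, nsmul_eq_mul]
    _ ≤ m * ∑ j ∈ Finset.Icc 1 K, m * s j ^ 2 := by
        gcongr with j hj
        have hsub : (Finset.Icc 1 K).filter (fun k => j ≤ k ∧ k < j + m)
            ⊆ Finset.Ico j (j + m) := fun k hk => by
          rw [Finset.mem_filter] at hk
          exact Finset.mem_Ico.2 hk.2
        have := Finset.card_le_card hsub
        simpa using this
    _ = _ := by rw [← Finset.mul_sum]; ring

theorem sum_sq_div_le {e : ℝ} (he : 0 < e) (hs : ∀ k, 0 ≤ s k) (K : ℕ) :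
    (∑ j ∈ Finset.Icc 1 K, s j ^ 2) / e ^ 2
      ≤ K + (∑ j ∈ Finset.range K, s (j + 1) ^ 3) / e ^ 3 := by
  have hre : ∑ j ∈ Finset.range K, s (j + 1) ^ 3 = ∑ j ∈ Finset.Icc 1 K, s j ^ 3 := by
    rw [Finset.range_eq_Ico, Finset.sum_Ico_add' (fun j => s j ^ 3) 0 K 1]
    rfl
  rw [hre, Finset.sum_div, Finset.sum_div]
  have hK : (K : ℝ) = ∑ _j ∈ Finset.Icc 1 K, (1 : ℝ) := by simp
  rw [hK, ← Finset.sum_add_distrib]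
  refine Finset.sum_le_sum fun j _ => ?_
  rw [← div_pow, ← div_pow]
  have hx : 0 ≤ s j / e := div_nonneg (hs j) he.le
  generalize s j / e = y at hx
  rcases le_total y 1 with h | h
  · nlinarith [pow_nonneg hx 3]
  · nlinarith [mul_nonneg (sq_nonneg y) (sub_nonneg.2 h)]

end Sequences

/-! ### Sizes of the batches -/

section Sizes

variable {d : ℕ} {L α e ζ : ℝ} {x z s : Vec d}

theorem hessBatchSize_le (hL : 0 ≤ L) (hα : 0 < α) (he : 0 < e)
    (hl : 0 ≤ Real.log (4 * d / ζ)) :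
    (hessBatchSize d L α e ζ x z s : ℝ) ≤ 2
      + (4 * L / (3 * α) + (8 * L ^ 2 / α ^ 2 + 4 * L / (3 * α)) * (‖x - z‖ ^ 2 / e ^ 2))
        * Real.log (4 * d / ζ) := by
  have h1 : 8 * L ^ 2 / (α ^ 2 * max (‖s‖ ^ 2) (e ^ 2)) * ‖x - z‖ ^ 2
      ≤ 8 * L ^ 2 / α ^ 2 * (‖x - z‖ ^ 2 / e ^ 2) := by
    calc _ ≤ 8 * L ^ 2 / (α ^ 2 * e ^ 2) * ‖x - z‖ ^ 2 := by
          gcongr; exact le_max_right _ _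
      _ = _ := by field_simp
  have h2 : 4 * L / (3 * α * max ‖s‖ e) * ‖x - z‖
      ≤ 4 * L / (3 * α) * (1 + ‖x - z‖ ^ 2 / e ^ 2) := by
    calc _ ≤ 4 * L / (3 * α * e) * ‖x - z‖ := by
          gcongr; exact le_max_right _ _
      _ = 4 * L / (3 * α) * (‖x - z‖ / e) := by field_simp
      _ ≤ _ := by
        gcongr
        rw [← div_pow]
        nlinarith [sq_nonneg (‖x - z‖ / e - 1 / 2)]
  set A := 8 * L ^ 2 / (α ^ 2 * max (‖s‖ ^ 2) (e ^ 2)) * ‖x - z‖ ^ 2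
      + 4 * L / (3 * α * max ‖s‖ e) * ‖x - z‖ with hA
  have hA0 : 0 ≤ A := by
    have := he.trans_le (le_max_right ‖s‖ e)
    positivity
  have h3 : (hessBatchSize d L α e ζ x z s : ℝ) ≤ 2 + A * Real.log (4 * d / ζ) := by
    rw [hessBatchSize, Nat.cast_max]
    have := Nat.ceil_lt_add_one (mul_nonneg hA0 hl)
    refine max_le ?_ ?_
    · have := mul_nonneg hA0 hl
      push_cast; linarith
    · linarith
  refine h3.trans ?_
  gcongr
  linarith

/-- The first term of the batch size alone gives the condition `n t² ≥ 8 r² ℓ` of the tail bound. -/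
theorem hessBatchSize_spec (hα : 0 < α) (he : 0 < e) (hL : 0 ≤ L)
    (hl : 0 ≤ Real.log (4 * d / ζ)) :
    8 * (L * ‖x - z‖) ^ 2 * Real.log (4 * d / ζ)
      ≤ hessBatchSize d L α e ζ x z s * (α * max ‖s‖ e) ^ 2 := by
  have hmax : 0 < max ‖s‖ e := he.trans_le (le_max_right _ _)
  have hsq : max (‖s‖ ^ 2) (e ^ 2) = max ‖s‖ e ^ 2 := by
    rcases le_total ‖s‖ e with h | h
    · rw [max_eq_right h, max_eq_right (pow_le_pow_left₀ (norm_nonneg _) h 2)]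
    · rw [max_eq_left h, max_eq_left (pow_le_pow_left₀ he.le h 2)]
  have h1 : 8 * L ^ 2 / (α ^ 2 * max ‖s‖ e ^ 2) * ‖x - z‖ ^ 2 * Real.log (4 * d / ζ)
      ≤ hessBatchSize d L α e ζ x z s := by
    rw [hessBatchSize, hsq, Nat.cast_max]
    refine le_trans ?_ ((Nat.le_ceil _).trans (le_max_right _ _))
    gcongr
    have : 0 ≤ 4 * L / (3 * α * max ‖s‖ e) * ‖x - z‖ := by positivity
    linarith
  refine le_trans (le_of_eq ?_) (mul_le_mul_of_nonneg_right h1 (sq_nonneg _))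
  field_simp

theorem gradBatchSize_spec (hα : 0 < α) (he : 0 < e) (hL : 0 ≤ L)
    (hl : 0 ≤ Real.log (2 * (d + 1) / ζ)) :
    8 * (L * ‖x - z‖) ^ 2 * Real.log (2 * (d + 1) / ζ)
      ≤ gradBatchSize d L α e ζ x z s * (α * max (‖s‖ ^ 2) (e ^ 2)) ^ 2 := by
  have hmax : 0 < max (‖s‖ ^ 2) (e ^ 2) := (by positivity : 0 < e ^ 2).trans_le (le_max_right _ _)
  have hsq : max (‖s‖ ^ 4) (e ^ 4) = max (‖s‖ ^ 2) (e ^ 2) ^ 2 := by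
    rcases le_total ‖s‖ e with h | h
    · rw [max_eq_right (pow_le_pow_left₀ (norm_nonneg _) h 2),
        max_eq_right (pow_le_pow_left₀ (norm_nonneg _) h 4), ← pow_mul]
    · rw [max_eq_left (pow_le_pow_left₀ he.le h 2),
        max_eq_left (pow_le_pow_left₀ he.le h 4), ← pow_mul]
  have h1 : 8 * L ^ 2 / (α ^ 2 * max (‖s‖ ^ 2) (e ^ 2) ^ 2) * ‖x - z‖ ^ 2
        * Real.log (2 * (d + 1) / ζ)
      ≤ gradBatchSize d L α e ζ x z s := by
    rw [gradBatchSize, hsq, Nat.cast_max]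
    refine le_trans ?_ ((Nat.le_ceil _).trans (le_max_right _ _))
    gcongr
    have : 0 ≤ 4 * L / (3 * α * max (‖s‖ ^ 2) (e ^ 2)) * ‖x - z‖ := by positivity
    linarith
  refine le_trans (le_of_eq ?_) (mul_le_mul_of_nonneg_right h1 (sq_nonneg _))
  field_simp

end Sizes

/-! ### Fresh samples are independent of the current state -/

section SampleSigma

variable {Ω : Type*} {N : ℕ} {J : Type*} {X : J → Ω → Fin N}

/-- The σ-algebra generated by the samples with index in `S`. -/
abbrev sampleSigma (X : J → Ω → Fin N) (S : Set J) : MeasurableSpace Ω :=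
  ⨆ i ∈ S, MeasurableSpace.comap (X i) inferInstance

theorem measurable_sampleSigma {S : Set J} {i : J} (hi : i ∈ S) :
    Measurable[sampleSigma X S] (X i) :=
  Measurable.mono (comap_measurable (X i))
    (le_iSup₂_of_le (f := fun i (_ : i ∈ S) => MeasurableSpace.comap (X i) inferInstance)
      i hi le_rfl) le_rfl

theorem sampleSigma_mono {S T : Set J} (h : S ⊆ T) : sampleSigma X S ≤ sampleSigma X T :=
  biSup_mono h

end SampleSigma

section Fresh

variable {Ω : Type*} [MeasurableSpace Ω] {P : Measure Ω} {N : ℕ}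
  {J : Type*} {X : J → Ω → Fin N}

theorem sampleSigma_le (hX : ∀ i, Measurable (X i)) (S : Set J) :
    sampleSigma X S ≤ ‹MeasurableSpace Ω› :=
  iSup₂_le fun i _ => (hX i).comap_le

theorem measureReal_inter_batch (hX : ∀ i, Measurable (X i)) (hind : iIndepFun X P)
    (hunif : ∀ i a, P {ω | X i ω = a} = (N : ENNReal)⁻¹) {S : Set J} {q : ℕ → J}
    (hq : Function.Injective q) (hqS : ∀ j, q j ∉ S) {G : Set Ω}
    (hG : MeasurableSet[sampleSigma X S] G) {n : ℕ} (w : Fin n → Fin N) :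
    P.real (G ∩ {ω | (fun j : Fin n => X (q j) ω) = w}) = P.real G * ((N : ℝ)⁻¹) ^ n := by
  have hset : {ω | (fun j : Fin n => X (q j) ω) = w}
      = ⋂ j ∈ (Finset.univ : Finset (Fin n)), X (q j) ⁻¹' {w j} := by
    ext ω; simp [funext_iff]
  have hmeas : MeasurableSet[sampleSigma X Sᶜ] {ω | (fun j : Fin n => X (q j) ω) = w} := by
    rw [hset]
    refine Finset.measurableSet_biInter _ fun j _ => ?_
    exact measurable_sampleSigma (hqS j) (measurableSet_singleton _)
  have h1 : Indep (sampleSigma X S) (sampleSigma X Sᶜ) P :=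
    indep_iSup_of_disjoint (fun i => (hX i).comap_le) hind disjoint_compl_right
  have h2 := (Indep_iff _ _ P).1 h1 _ _ hG hmeas
  have h3 : P {ω | (fun j : Fin n => X (q j) ω) = w} = ((N : ENNReal)⁻¹) ^ n := by
    have hprec := hind.precomp (g := fun j : Fin n => q j) (hq.comp Fin.val_injective)
    rw [hset, hprec.measure_inter_preimage_eq_mul Finset.univ (sets := fun j => {w j})
      (fun j _ => measurableSet_singleton _)]
    have : ∀ j : Fin n, P (X (q j) ⁻¹' {w j}) = (N : ENNReal)⁻¹ := fun j => hunif (q j) (w j)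
    simp [this]
  rw [measureReal_def, h2, h3, ENNReal.toReal_mul, measureReal_def]
  simp

/-- If a state `Y` is determined by earlier samples and takes finitely many values, and if for every
value of `Y` at most a fraction `η` of the sample lists is bad, then a fresh batch is bad with
probability at most `η`. The batch size may depend on the state. -/
theorem measureReal_bad_batch_le [IsProbabilityMeasure P]
    (hX : ∀ i, Measurable (X i)) (hind : iIndepFun X P)
    (hunif : ∀ i a, P {ω | X i ω = a} = (N : ENNReal)⁻¹) (hN : 0 < N) {S : Set J} {q : ℕ → J}
    (hq : Function.Injective q) (hqS : ∀ j, q j ∉ S) {T : Type*} {Y : Ω → T}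
    (hfin : (Set.range Y).Finite) (hY : ∀ σ, MeasurableSet[sampleSigma X S] {ω | Y ω = σ})
    (n : T → ℕ) (Bad : ∀ σ, (Fin (n σ) → Fin N) → Prop) {η : ℝ} (hη : 0 ≤ η)
    (hBad : ∀ σ, (Nat.card {w // Bad σ w} : ℝ) ≤ η * Fintype.card (Fin (n σ) → Fin N)) :
    P.real {ω | Bad (Y ω) (fun j => X (q j) ω)} ≤ η := by
  classical
  have hN' : (N : ℝ) ≠ 0 := by exact_mod_cast hN.ne'
  have hsub : {ω | Bad (Y ω) (fun j => X (q j) ω)} ⊆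
      ⋃ σ ∈ hfin.toFinset, ⋃ w ∈ Finset.univ.filter (Bad σ),
        {ω | Y ω = σ} ∩ {ω | (fun j : Fin (n σ) => X (q j) ω) = w} := by
    intro ω hω
    simp only [Set.mem_iUnion]
    refine ⟨Y ω, by simp, (fun j => X (q j) ω), ?_, rfl, rfl⟩
    simpa using hω
  calc P.real {ω | Bad (Y ω) (fun j => X (q j) ω)}
      ≤ P.real (⋃ σ ∈ hfin.toFinset, ⋃ w ∈ Finset.univ.filter (Bad σ),
        {ω | Y ω = σ} ∩ {ω | (fun j : Fin (n σ) => X (q j) ω) = w}) :=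
        measureReal_mono hsub (measure_ne_top _ _)
    _ ≤ ∑ σ ∈ hfin.toFinset, ∑ w ∈ Finset.univ.filter (Bad σ),
        P.real ({ω | Y ω = σ} ∩ {ω | (fun j : Fin (n σ) => X (q j) ω) = w}) :=
        (measureReal_biUnion_finset_le _ _).trans
          (Finset.sum_le_sum fun σ _ => measureReal_biUnion_finset_le _ _)
    _ ≤ ∑ σ ∈ hfin.toFinset, P.real {ω | Y ω = σ} * η := by
        refine Finset.sum_le_sum fun σ _ => ?_
        simp only [measureReal_inter_batch hX hind hunif hq hqS (hY σ)]
        rw [Finset.sum_const, nsmul_eq_mul, mul_left_comm]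
        refine mul_le_mul_of_nonneg_left ?_ measureReal_nonneg
        have h1 := hBad σ
        rw [Nat.card_eq_fintype_card, Fintype.card_subtype] at h1
        calc _ ≤ (η * Fintype.card (Fin (n σ) → Fin N)) * ((N : ℝ)⁻¹) ^ n σ := by gcongr
          _ = η := by
            rw [Fintype.card_fun, Fintype.card_fin, Fintype.card_fin, Nat.cast_pow, inv_pow,
              mul_assoc, mul_inv_cancel₀ (pow_ne_zero _ hN'), mul_one]
    _ = P.real (⋃ σ ∈ hfin.toFinset, {ω | Y ω = σ}) * η := by
        rw [← Finset.sum_mul, measureReal_biUnion_finset]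
        · intro σ _ τ _ hστ
          exact Set.disjoint_left.2 fun ω h1 h2 => hστ (h1.symm.trans h2)
        · exact fun σ _ => sampleSigma_le hX S _ (hY σ)
    _ ≤ 1 * η := mul_le_mul_of_nonneg_right measureReal_le_one hη
    _ = η := one_mul η

end Fresh

section Run

variable {d N : ℕ} (f : Fin N → Vec d → ℝ) (I : Input d)

theorem batchMean_congr {V : Type*} [AddCommGroup V] [Module ℝ V] {n : ℕ} {ξ ξ' : ℕ → Fin N}
    (h : ∀ j < n, ξ j = ξ' j) (u : Fin N → V) : batchMean n ξ u = batchMean n ξ' u := by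
  rw [batchMean, batchMean]
  congr 1
  exact Finset.sum_congr rfl fun j hj => by rw [h j (Finset.mem_range.1 hj)]

/-- An iteration from a given state reads only finitely many samples. -/
theorem step_congr (k : ℕ) (σ : State d) : ∃ n, ∀ ξg ξg' ξH ξH' : ℕ → Fin N,
    (∀ j < n, ξg j = ξg' j) → (∀ j < n, ξH j = ξH' j) →
      step f I k ξg ξH σ = step f I k ξg' ξH' σ := by
  refine ⟨max (I.gradBatch σ.x (snapshot I k σ) σ.s) (I.hessBatch σ.x (snapshot I k σ) σ.s),
    fun ξg ξg' ξH ξH' hg hH => ?_⟩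
  have e1 : gradEstimate f I k ξg σ = gradEstimate f I k ξg' σ := by
    rw [gradEstimate, gradEstimate,
      batchMean_congr fun j hj => hg j (hj.trans_le (le_max_left _ _))]
  have e2 : hessEstimate f I k ξH σ = hessEstimate f I k ξH' σ := by
    rw [hessEstimate, hessEstimate,
      batchMean_congr fun j hj => hH j (hj.trans_le (le_max_right _ _))]
  rw [step, step, e1, e2]

variable {Ω : Type*} (ξg ξH : ℕ → ℕ → Ω → Fin N)

/-- All samples as one family: gradient samples on the left, Hessian samples on the right. -/
def allSamples : (ℕ × ℕ) ⊕ (ℕ × ℕ) → Ω → Fin N :=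
  Sum.elim (fun p : ℕ × ℕ => ξg p.1 p.2) (fun p : ℕ × ℕ => ξH p.1 p.2)

/-- The indices of the samples drawn before iteration `k`. -/
def before (k : ℕ) : Set ((ℕ × ℕ) ⊕ (ℕ × ℕ)) :=
  {p | Sum.elim (fun p : ℕ × ℕ => p.1) (fun p : ℕ × ℕ => p.1) p < k}

/-- The state before iteration `k` is a simple function of the earlier samples. Both facts are
proved together, because finiteness is what makes the next state a finite case distinction; no
measurability of the oracle is needed. -/
theorem finite_range_run (hN : 0 < N) (k : ℕ) :
    (Set.range fun ω => run f I (fun k j => ξg k j ω) (fun k j => ξH k j ω) k).Finite ∧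
    ∀ σ, MeasurableSet[sampleSigma (allSamples ξg ξH) (before k)]
      {ω | run f I (fun k j => ξg k j ω) (fun k j => ξH k j ω) k = σ} := by
  induction k with
  | zero =>
    refine ⟨(Set.finite_singleton (⟨I.x₀, I.s₀, I.x₀⟩ : State d)).subset ?_, fun σ => ?_⟩
    · rintro _ ⟨ω, rfl⟩
      rfl
    · simp only [run]
      exact MeasurableSet.const _
  | succ k ih =>
    obtain ⟨hfin, hmeas⟩ := ih
    set Y : Ω → State d := fun ω => run f I (fun k j => ξg k j ω) (fun k j => ξH k j ω) k with hY
    choose n hn using step_congr f I k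
    let ext : (n : ℕ) → (Fin n → Fin N) → ℕ → Fin N :=
      fun n w j => if h : j < n then w ⟨j, h⟩ else ⟨0, hN⟩
    let Φ : (σ : State d) → (Fin (n σ) → Fin N) × (Fin (n σ) → Fin N) → State d :=
      fun σ p => step f I k (ext _ p.1) (ext _ p.2) σ
    have hΦ : ∀ σ ω, step f I k (fun j => ξg k j ω) (fun j => ξH k j ω) σ
        = Φ σ (fun j => ξg k j ω, fun j => ξH k j ω) := fun σ ω =>
      hn σ _ _ _ _ (fun j hj => by simp [ext, hj]) (fun j hj => by simp [ext, hj])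
    have hrun : ∀ ω, run f I (fun k j => ξg k j ω) (fun k j => ξH k j ω) (k + 1)
        = Φ (Y ω) (fun j => ξg k j ω, fun j => ξH k j ω) := fun ω => hΦ (Y ω) ω
    refine ⟨?_, fun τ => ?_⟩
    · refine (hfin.biUnion fun σ _ => Set.finite_range (Φ σ)).subset ?_
      rintro _ ⟨ω, rfl⟩
      simp only [hrun]
      exact Set.mem_biUnion (Set.mem_range_self ω) (Set.mem_range_self _)
    · have hset : {ω | run f I (fun k j => ξg k j ω) (fun k j => ξH k j ω) (k + 1) = τ}
          = ⋃ σ ∈ hfin.toFinset, {ω | Y ω = σ} ∩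
            (fun ω => ((fun j : Fin (n σ) => ξg k j ω), fun j : Fin (n σ) => ξH k j ω)) ⁻¹'
              (Φ σ ⁻¹' {τ}) := by
        ext ω
        simp only [Set.mem_ofPred_eq, hrun, Set.mem_iUnion, Set.mem_inter_iff, Set.mem_preimage,
          Set.mem_singleton_iff]
        constructor
        · intro h
          exact ⟨Y ω, by simp, rfl, h⟩
        · rintro ⟨σ, -, rfl, h⟩
          exact h
      rw [hset]
      have hmono : sampleSigma (allSamples ξg ξH) (before k)
          ≤ sampleSigma (allSamples ξg ξH) (before (k + 1)) :=
        sampleSigma_mono fun p hp => Nat.lt_succ_of_lt hp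
      refine Finset.measurableSet_biUnion _ fun σ _ => (hmono _ (hmeas σ)).inter ?_
      have h1 : Measurable[sampleSigma (allSamples ξg ξH) (before (k + 1))]
          (fun ω => fun j : Fin (n σ) => ξg k j ω) :=
        @measurable_pi_lambda _ _ _ (_) _ _ fun j => measurable_sampleSigma
          (X := allSamples ξg ξH) (i := Sum.inl (k, (j : ℕ))) (Nat.lt_succ_self k)
      have h2 : Measurable[sampleSigma (allSamples ξg ξH) (before (k + 1))]
          (fun ω => fun j : Fin (n σ) => ξH k j ω) :=
        @measurable_pi_lambda _ _ _ (_) _ _ fun j => measurable_sampleSigma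
          (X := allSamples ξg ξH) (i := Sum.inr (k, (j : ℕ))) (Nat.lt_succ_self k)
      exact (h1.prodMk h2) (Set.toFinite _).measurableSet

end Run

/-! ### Accuracy of the estimates in one iteration -/

section Estimates

variable {d N : ℕ} {f : Fin N → Vec d → ℝ} {I : Input d} {k : ℕ} {ξ : ℕ → Fin N} {σ : State d}

theorem batchMean_eq_sum_fin {V : Type*} [AddCommGroup V] [Module ℝ V] (n : ℕ)
    (h : Fin N → V) : batchMean n ξ h = (n : ℝ)⁻¹ • ∑ j : Fin n, h (ξ j) := by
  rw [batchMean, Finset.sum_range (fun j => h (ξ j))]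

theorem gradEstimate_of_mod_eq_zero (hk : k % I.m = 0) :
    gradEstimate f I k ξ σ = gradient (objective f) σ.x := by
  rw [gradEstimate, if_pos hk]

theorem hessEstimate_of_mod_eq_zero (hk : k % I.m = 0) :
    hessEstimate f I k ξ σ = hessian (objective f) σ.x := by
  rw [hessEstimate, if_pos hk]

theorem gradEstimate_sub_gradient (hf : ∀ i, ContDiff ℝ 2 (f i)) (hk : k % I.m ≠ 0) :
    gradEstimate f I k ξ σ - gradient (objective f) σ.x
      = ((I.gradBatch σ.x σ.snap σ.s : ℕ) : ℝ)⁻¹ • ∑ j : Fin (I.gradBatch σ.x σ.snap σ.s),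
          (gradient (f (ξ j)) σ.x - gradient (f (ξ j)) σ.snap)
        - (N : ℝ)⁻¹ • ∑ i, (gradient (f i) σ.x - gradient (f i) σ.snap) := by
  rw [gradEstimate, if_neg hk, snapshot, if_neg hk,
    batchMean_eq_sum_fin _ (fun i => gradient (f i) σ.x - gradient (f i) σ.snap),
    gradient_objective hf, gradient_objective hf,
    Finset.sum_sub_distrib (s := (Finset.univ : Finset (Fin N))), smul_sub (N : ℝ)⁻¹]
  abel

theorem hessEstimate_sub_hessian (hf : ∀ i, ContDiff ℝ 2 (f i)) (hk : k % I.m ≠ 0) :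
    hessEstimate f I k ξ σ - hessian (objective f) σ.x
      = ((I.hessBatch σ.x σ.snap σ.s : ℕ) : ℝ)⁻¹ • ∑ j : Fin (I.hessBatch σ.x σ.snap σ.s),
          (hessian (f (ξ j)) σ.x - hessian (f (ξ j)) σ.snap)
        - (N : ℝ)⁻¹ • ∑ i, (hessian (f i) σ.x - hessian (f i) σ.snap) := by
  have e : (N : ℝ)⁻¹ • ∑ i, (hessian (f i) σ.x - hessian (f i) σ.snap)
      = (N : ℝ)⁻¹ • ∑ i, hessian (f i) σ.x - (N : ℝ)⁻¹ • ∑ i, hessian (f i) σ.snap := by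
    rw [Finset.sum_sub_distrib]
    exact smul_sub _ _ _
  rw [hessEstimate, if_neg hk, snapshot, if_neg hk,
    batchMean_eq_sum_fin _ (fun i => hessian (f i) σ.x - hessian (f i) σ.snap),
    hessian_objective hf, hessian_objective hf, e]
  abel

theorem hessEstimate_isSelfAdjoint (hf : ∀ i, ContDiff ℝ 2 (f i)) :
    IsSelfAdjoint (hessEstimate f I k ξ σ) := by
  have hF := contDiff_objective hf
  rw [hessEstimate]
  split_ifs
  · exact hessian_isSelfAdjoint hF _
  · have h1 : ∀ i ∈ Finset.range (I.hessBatch σ.x (snapshot I k σ) σ.s), IsSelfAdjoint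
        (hessian (f (ξ i)) σ.x - hessian (f (ξ i)) (snapshot I k σ)) := fun i _ =>
      IsSelfAdjoint.sub (R := Op d) (hessian_isSelfAdjoint (hf _) _)
        (hessian_isSelfAdjoint (hf _) _)
    have h2 := isSelfAdjoint_sum (R := Op d) _ h1
    have h3 : IsSelfAdjoint (((I.hessBatch σ.x (snapshot I k σ) σ.s : ℕ) : ℝ)⁻¹) :=
      IsSelfAdjoint.all _
    exact IsSelfAdjoint.add (R := Op d) (h3.smul h2) (hessian_isSelfAdjoint hF _)

theorem three_le_log {y ζ : ℝ} (hζ : 0 < ζ) (hζ' : ζ ≤ 1 / 10) (hy : 4 ≤ y) :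
    3 ≤ Real.log (y / ζ) := by
  have h1 : (40 : ℝ) ≤ y / ζ := by
    rw [le_div_iff₀ hζ]; linarith
  rw [Real.le_log_iff_exp_le (by linarith)]
  have h2 : Real.exp 3 = Real.exp 1 ^ 3 := by rw [← Real.exp_nat_mul]; norm_num
  have h3 : Real.exp 1 ^ 3 ≤ 3 ^ 3 :=
    pow_le_pow_left₀ (Real.exp_pos 1).le (by linarith [Real.exp_one_lt_d9]) 3
  rw [h2]
  linarith

theorem mul_exp_neg_log {y ζ : ℝ} (hζ : 0 < ζ) (hy : 0 < y) :
    y * Real.exp (-Real.log (y / ζ)) = ζ := by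
  rw [Real.exp_neg, Real.exp_log (by positivity)]
  field_simp

variable {Ω : Type*} [MeasurableSpace Ω] {P : Measure Ω}
  {ξg ξH : ℕ → ℕ → Ω → Fin N} {L₀ L₁ L₂ : ℝ≥0} {α β e ζ : ℝ}

theorem measurable_allSamples (hU : UniformSampling P ξg ξH) (i : (ℕ × ℕ) ⊕ (ℕ × ℕ)) :
    Measurable (allSamples ξg ξH i) := by
  rcases i with p | p
  · exact hU.measurable_grad _ _
  · exact hU.measurable_hess _ _

theorem uniform_allSamples (hU : UniformSampling P ξg ξH) (i : (ℕ × ℕ) ⊕ (ℕ × ℕ)) (a : Fin N) :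
    P {ω | allSamples ξg ξH i ω = a} = (N : ENNReal)⁻¹ := by
  rcases i with p | p
  · exact hU.uniform_grad _ _ _
  · exact hU.uniform_hess _ _ _

theorem measureReal_gradEstimate_bad_le [IsProbabilityMeasure P]
    (hU : UniformSampling P ξg ξH) (hN : 0 < N) (hd : 0 < d)
    (hf : RegularObjective f L₀ L₁ L₂) (hβ : 0 < β) (he : 0 < e) (hζ : 0 < ζ) (hζ' : ζ ≤ 1 / 10)
    (hI : I.gradBatch = gradBatchSize d L₁ β e ζ) (k : ℕ) :
    P.real {ω | β * max (‖(run f I (fun k j => ξg k j ω) (fun k j => ξH k j ω) k).s‖ ^ 2) (e ^ 2)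
      < ‖gradEstimate f I k (fun j => ξg k j ω)
          (run f I (fun k j => ξg k j ω) (fun k j => ξH k j ω) k)
        - gradient (objective f) (run f I (fun k j => ξg k j ω) (fun k j => ξH k j ω) k).x‖}
      ≤ ζ / 2 := by
  have : Nonempty (Fin N) := ⟨⟨0, hN⟩⟩
  have hd1 : (1 : ℝ) ≤ d := by exact_mod_cast hd
  by_cases hk : k % I.m = 0
  · have hempty : {ω | β *
        max (‖(run f I (fun k j => ξg k j ω) (fun k j => ξH k j ω) k).s‖ ^ 2) (e ^ 2)
        < ‖gradEstimate f I k (fun j => ξg k j ω)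
          (run f I (fun k j => ξg k j ω) (fun k j => ξH k j ω) k)
        - gradient (objective f) (run f I (fun k j => ξg k j ω) (fun k j => ξH k j ω) k).x‖}
        = ∅ := by
      refine Set.eq_empty_of_forall_notMem fun ω hω => ?_
      rw [Set.mem_ofPred_eq, gradEstimate_of_mod_eq_zero hk, sub_self, norm_zero] at hω
      exact absurd hω (not_lt.2 (mul_nonneg hβ.le ((sq_nonneg e).trans (le_max_right _ _))))
    rw [hempty, measureReal_empty]
    linarith
  have hl : 3 ≤ Real.log (2 * (d + 1) / ζ) := three_le_log hζ hζ' (by linarith)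
  obtain ⟨hfin, hmeas⟩ := finite_range_run f I ξg ξH hN k
  have key := measureReal_bad_batch_le (P := P) (measurable_allSamples hU) hU.indep
    (uniform_allSamples hU) hN (q := fun j => Sum.inl (k, j)) (S := before k)
    (fun i j h => by simpa using h) (fun j => by simp [before]) hfin hmeas
    (fun σ => I.gradBatch σ.x σ.snap σ.s)
    (fun σ w => β * max (‖σ.s‖ ^ 2) (e ^ 2)
      < ‖((I.gradBatch σ.x σ.snap σ.s : ℕ) : ℝ)⁻¹ • ∑ j : Fin (I.gradBatch σ.x σ.snap σ.s),
          (gradient (f (w j)) σ.x - gradient (f (w j)) σ.snap)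
        - (N : ℝ)⁻¹ • ∑ i, (gradient (f i) σ.x - gradient (f i) σ.snap)‖)
    (η := ζ / 2) (by linarith) (fun σ => by
      have ht : 0 < max (‖σ.s‖ ^ 2) (e ^ 2) :=
        (by positivity : 0 < e ^ 2).trans_le (le_max_right _ _)
      have hn : 0 < I.gradBatch σ.x σ.snap σ.s := by
        rw [hI]; exact lt_of_lt_of_le one_pos (le_max_left _ _)
      have h1 := card_mean_deviation_vec_le (κ := Fin (I.gradBatch σ.x σ.snap σ.s))
        (h := fun i => gradient (f i) σ.x - gradient (f i) σ.snap)
        (r := L₁ * ‖σ.x - σ.snap‖) (t := β * max (‖σ.s‖ ^ 2) (e ^ 2))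
        (l := Real.log (2 * (d + 1) / ζ))
        (fun i => (hf.lipschitz_gradient i).norm_sub_le _ _) (by positivity) hl
        (by rwa [Fintype.card_fin])
        (by
          rw [Fintype.card_fin, hI]
          exact gradBatchSize_spec hβ he L₁.coe_nonneg (by linarith))
      simp only [Fintype.card_fin (I.gradBatch σ.x σ.snap σ.s), Fintype.card_fin N,
        finrank_euclideanSpace_fin] at h1
      refine h1.trans (le_of_eq ?_)
      congr 1
      have := mul_exp_neg_log hζ (y := 2 * ((d : ℝ) + 1)) (by positivity)
      linarith)
  refine le_trans (le_of_eq ?_) key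
  congr 1
  ext ω
  rw [Set.mem_ofPred_eq, Set.mem_ofPred_eq, gradEstimate_sub_gradient hf.contDiff hk]
  rfl

theorem measureReal_hessEstimate_bad_le [IsProbabilityMeasure P]
    (hU : UniformSampling P ξg ξH) (hN : 0 < N) (hd : 0 < d)
    (hf : RegularObjective f L₀ L₁ L₂) (hα : 0 < α) (he : 0 < e) (hζ : 0 < ζ) (hζ' : ζ ≤ 1 / 10)
    (hI : I.hessBatch = hessBatchSize d L₂ α e ζ) (k : ℕ) :
    P.real {ω | α * max ‖(run f I (fun k j => ξg k j ω) (fun k j => ξH k j ω) k).s‖ e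
      < ‖hessEstimate f I k (fun j => ξH k j ω)
          (run f I (fun k j => ξg k j ω) (fun k j => ξH k j ω) k)
        - hessian (objective f) (run f I (fun k j => ξg k j ω) (fun k j => ξH k j ω) k).x‖}
      ≤ ζ / 4 := by
  have : Nonempty (Fin N) := ⟨⟨0, hN⟩⟩
  have hd1 : (1 : ℝ) ≤ d := by exact_mod_cast hd
  by_cases hk : k % I.m = 0
  · have hempty : {ω | α *
        max ‖(run f I (fun k j => ξg k j ω) (fun k j => ξH k j ω) k).s‖ e
        < ‖hessEstimate f I k (fun j => ξH k j ω)
          (run f I (fun k j => ξg k j ω) (fun k j => ξH k j ω) k)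
        - hessian (objective f) (run f I (fun k j => ξg k j ω) (fun k j => ξH k j ω) k).x‖}
        = ∅ := by
      refine Set.eq_empty_of_forall_notMem fun ω hω => ?_
      rw [Set.mem_ofPred_eq, hessEstimate_of_mod_eq_zero hk, sub_self, norm_zero] at hω
      exact absurd hω (not_lt.2 (mul_nonneg hα.le (he.le.trans (le_max_right _ _))))
    rw [hempty, measureReal_empty]
    linarith
  have hl : 3 ≤ Real.log (4 * d / ζ) := three_le_log hζ hζ' (by linarith)
  obtain ⟨hfin, hmeas⟩ := finite_range_run f I ξg ξH hN k
  have key := measureReal_bad_batch_le (P := P) (measurable_allSamples hU) hU.indep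
    (uniform_allSamples hU) hN (q := fun j => Sum.inr (k, j)) (S := before k)
    (fun i j h => by simpa using h) (fun j => by simp [before]) hfin hmeas
    (fun σ => I.hessBatch σ.x σ.snap σ.s)
    (fun σ w => α * max ‖σ.s‖ e
      < ‖((I.hessBatch σ.x σ.snap σ.s : ℕ) : ℝ)⁻¹ • ∑ j : Fin (I.hessBatch σ.x σ.snap σ.s),
          (hessian (f (w j)) σ.x - hessian (f (w j)) σ.snap)
        - (N : ℝ)⁻¹ • ∑ i, (hessian (f i) σ.x - hessian (f i) σ.snap)‖)
    (η := ζ / 4) (by linarith) (fun σ => by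
      have ht : 0 < max ‖σ.s‖ e := he.trans_le (le_max_right _ _)
      have hn : 0 < I.hessBatch σ.x σ.snap σ.s := by
        rw [hI]; exact lt_of_lt_of_le one_pos (le_max_left _ _)
      have h1 := card_mean_deviation_op_le (κ := Fin (I.hessBatch σ.x σ.snap σ.s))
        (h := fun i => hessian (f i) σ.x - hessian (f i) σ.snap)
        (fun i => ContinuousLinearMap.isSelfAdjoint_iff_isSymmetric.1
          ((hessian_isSelfAdjoint (hf.contDiff i) _).sub
            (hessian_isSelfAdjoint (hf.contDiff i) _)))
        (r := L₂ * ‖σ.x - σ.snap‖) (t := α * max ‖σ.s‖ e)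
        (l := Real.log (4 * d / ζ))
        (fun i => (hf.lipschitz_hessian i).norm_sub_le _ _) (by positivity) hl
        (by rwa [Fintype.card_fin])
        (by
          rw [Fintype.card_fin, hI]
          exact hessBatchSize_spec hα he L₂.coe_nonneg (by linarith))
      simp only [Fintype.card_fin (I.hessBatch σ.x σ.snap σ.s), Fintype.card_fin N,
        finrank_euclideanSpace_fin] at h1
      refine h1.trans (le_of_eq ?_)
      congr 1
      have := mul_exp_neg_log hζ (y := 4 * (d : ℝ)) (by positivity)
      linarith)
  refine le_trans (le_of_eq ?_) key
  congr 1
  ext ω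
  rw [Set.mem_ofPred_eq, Set.mem_ofPred_eq, hessEstimate_sub_hessian hf.contDiff hk]
  rfl

end Estimates

/-! ### The constants -/

section Constants

variable {L₂ M α β : ℝ}

theorem tau_pos (hL : 0 ≤ L₂) (hM : 0 < M) (hα : 0 < α) (hβ : 0 < β) : 0 < tau L₂ M α β :=
  lt_min (Real.rpow_pos_of_pos (by positivity) _) (by positivity)

theorem mul_tau_sq_le (hL : 0 ≤ L₂) (hM : 0 < M) (hα : 0 < α) (hβ : 0 < β) :
    ((L₂ + M) / 2 + 2 * β + 2 * α) * tau L₂ M α β ^ 2 ≤ 1 := by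
  set p := (L₂ + M) / 2 + 2 * β + 2 * α with hp
  have hp0 : 0 < p := by positivity
  have h1 : tau L₂ M α β ^ 2 ≤ p⁻¹ := by
    calc tau L₂ M α β ^ 2 ≤ (p ^ (-(1 / 2) : ℝ)) ^ 2 :=
          pow_le_pow_left₀ (tau_pos hL hM hα hβ).le (min_le_left _ _) 2
      _ = p⁻¹ := by
        rw [← Real.rpow_natCast, ← Real.rpow_mul hp0.le, ← Real.rpow_neg_one]
        norm_num
  calc p * tau L₂ M α β ^ 2 ≤ p * p⁻¹ := by gcongr
    _ = 1 := mul_inv_cancel₀ hp0.ne'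

theorem mul_tau_le (hL : 0 ≤ L₂) (hM : 0 < M) (hα : 0 < α) :
    ((M + 2 * L₂) / 2 + 2 * α) * tau L₂ M α β ≤ 1 := by
  have hp0 : 0 < (M + 2 * L₂) / 2 + 2 * α := by positivity
  calc _ ≤ ((M + 2 * L₂) / 2 + 2 * α) * ((M + 2 * L₂) / 2 + 2 * α)⁻¹ := by
        gcongr; exact min_le_right _ _
    _ = 1 := mul_inv_cancel₀ hp0.ne'

theorem sqrt_pow_three {ε : ℝ} (hε : 0 < ε) : √ε ^ 3 = ε ^ (3 / 2 : ℝ) := by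
  rw [Real.sqrt_eq_rpow, ← Real.rpow_natCast, ← Real.rpow_mul hε.le]
  norm_num

/-- A bound for `∑ ‖s_k‖³` over the iterations in which the stopping test fails. -/
noncomputable def cubeBudget (L₂ M α β Δ : ℝ) : ℝ :=
  (|Δ| + (2 * β + α) * tau L₂ M α β ^ 3) / (2 * gammaConst L₂ M α β)

/-- The number of iterations is at most this constant times `ε^{-3/2}`. -/
noncomputable def iterConst (L₂ M α β Δ : ℝ) : ℝ :=
  2 * cubeBudget L₂ M α β Δ / tau L₂ M α β ^ 3 + 1

theorem cubeBudget_nonneg (Δ : ℝ) (hL : 0 ≤ L₂) (hM : 0 < M) (hα : 0 < α) (hβ : 0 < β)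
    (hγ : 0 < gammaConst L₂ M α β) : 0 ≤ cubeBudget L₂ M α β Δ := by
  have := tau_pos hL hM hα hβ
  have := abs_nonneg Δ
  rw [cubeBudget]
  positivity

theorem one_le_iterConst (Δ : ℝ) (hL : 0 ≤ L₂) (hM : 0 < M) (hα : 0 < α) (hβ : 0 < β)
    (hγ : 0 < gammaConst L₂ M α β) : 1 ≤ iterConst L₂ M α β Δ := by
  have := tau_pos hL hM hα hβ
  have := cubeBudget_nonneg Δ hL hM hα hβ hγ
  rw [iterConst]
  have : 0 ≤ 2 * cubeBudget L₂ M α β Δ / tau L₂ M α β ^ 3 := by positivity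
  linarith

end Constants

/-! ### The iteration count and the sample count on the event of accurate estimates -/

section Deterministic

variable {d N : ℕ} {f : Fin N → Vec d → ℝ} {L₀ L₁ L₂ : ℝ≥0} {M α β Δ ε : ℝ} {I : Input d}
  {ξg ξH : ℕ → ℕ → Fin N}

/-- Both estimates of iteration `k` are as accurate as the analysis needs. -/
def Accurate (f : Fin N → Vec d → ℝ) (I : Input d) (ξg ξH : ℕ → ℕ → Fin N) (α β : ℝ) (k : ℕ) :
    Prop :=
  ‖gradEstimate f I k (ξg k) (run f I ξg ξH k) - gradient (objective f) (run f I ξg ξH k).x‖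
      ≤ β * max (‖(run f I ξg ξH k).s‖ ^ 2) (I.ε₁ ^ 2) ∧
  ‖hessEstimate f I k (ξH k) (run f I ξg ξH k) - hessian (objective f) (run f I ξg ξH k).x‖
      ≤ α * max ‖(run f I ξg ξH k).s‖ I.ε₁

theorem run_succ_x (k : ℕ) :
    (run f I ξg ξH (k + 1)).x = (run f I ξg ξH k).x + (run f I ξg ξH (k + 1)).s := rfl

theorem run_succ_s_isMin (hf : ∀ i, ContDiff ℝ 2 (f i)) (hsolve : IsSubproblemOracle M I.solve)
    (k : ℕ) (u : Vec d) :
    cubicModel M (gradEstimate f I k (ξg k) (run f I ξg ξH k))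
        (hessEstimate f I k (ξH k) (run f I ξg ξH k)) (run f I ξg ξH (k + 1)).s
      ≤ cubicModel M (gradEstimate f I k (ξg k) (run f I ξg ξH k))
        (hessEstimate f I k (ξH k) (run f I ξg ξH k)) u :=
  hsolve _ _ (hessEstimate_isSelfAdjoint hf) u

theorem max_sq_mul_le {a b e : ℝ} (ha : 0 ≤ a) (hb : 0 ≤ b) (he : 0 ≤ e) :
    max (a ^ 2) (e ^ 2) * b ≤ a ^ 3 + b ^ 3 + e ^ 3 ∧
    max a e * b ^ 2 ≤ a ^ 3 + b ^ 3 + e ^ 3 := by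
  have key : ∀ c : ℝ, 0 ≤ c → c ^ 2 * b ≤ c ^ 3 + b ^ 3 ∧ c * b ^ 2 ≤ c ^ 3 + b ^ 3 := by
    intro c hc
    rcases le_total b c with h | h
    · exact ⟨by nlinarith [mul_le_mul_of_nonneg_left h (sq_nonneg c), pow_nonneg hb 3],
        by nlinarith [pow_le_pow_left₀ hb h 2, pow_nonneg hb 3]⟩
    · exact ⟨by nlinarith [pow_le_pow_left₀ hc h 2, pow_nonneg hc 3],
        by nlinarith [mul_le_mul_of_nonneg_left h (sq_nonneg b), pow_nonneg hc 3]⟩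
  have ha3 := pow_nonneg ha 3
  have he3 := pow_nonneg he 3
  constructor
  · rcases max_cases (a ^ 2) (e ^ 2) with ⟨h, -⟩ | ⟨h, -⟩ <;> rw [h]
    · linarith [(key a ha).1]
    · linarith [(key e he).1]
  · rcases max_cases a e with ⟨h, -⟩ | ⟨h, -⟩ <;> rw [h]
    · linarith [(key a ha).2]
    · linarith [(key e he).2]

theorem objective_run_succ_le (hN : 0 < N) (hf : RegularObjective f L₀ L₁ L₂) (hα : 0 < α)
    (hβ : 0 < β) (hsolve : IsSubproblemOracle M I.solve) (he : 0 ≤ I.ε₁) {k : ℕ}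
    (hk : Accurate f I ξg ξH α β k) :
    objective f (run f I ξg ξH (k + 1)).x ≤ objective f (run f I ξg ξH k).x
      - (3 * M - 2 * L₂) / 12 * ‖(run f I ξg ξH (k + 1)).s‖ ^ 3
      + (β + α / 2) * (‖(run f I ξg ξH k).s‖ ^ 3 + ‖(run f I ξg ξH (k + 1)).s‖ ^ 3
        + I.ε₁ ^ 3) := by
  have h1 := descent (contDiff_objective hf.contDiff)
    (lipschitzWith_hessian_objective hN hf.contDiff hf.lipschitz_hessian)
    (hessEstimate_isSelfAdjoint hf.contDiff) (run_succ_s_isMin hf.contDiff hsolve k) hk.1 hk.2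
  rw [run_succ_x]
  obtain ⟨h2, h3⟩ := max_sq_mul_le (norm_nonneg (run f I ξg ξH k).s)
    (norm_nonneg (run f I ξg ξH (k + 1)).s) he
  have h4 := mul_le_mul_of_nonneg_left h2 hβ.le
  have h5 := mul_le_mul_of_nonneg_left h3 (half_pos hα).le
  linarith

theorem sum_norm_step_cube_le (hN : 0 < N) (hf : RegularObjective f L₀ L₁ L₂)
    (hα : 0 < α) (hβ : 0 < β) (hγ : 0 < gammaConst L₂ M α β)
    (hsolve : IsSubproblemOracle M I.solve)
    (he : 0 < I.ε₁) (heτ : I.ε₁ ≤ tau L₂ M α β) (hs₀ : ‖I.s₀‖ = I.ε₁)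
    (hΔ : objective f I.x₀ - (⨅ x, objective f x) ≤ Δ) {n : ℕ}
    (hacc : ∀ k < n, Accurate f I ξg ξH α β k) (hns : ∀ k < n, ¬ StopTest f I ξg ξH k) :
    ∑ k ∈ Finset.range n, ‖(run f I ξg ξH (k + 1)).s‖ ^ 3 ≤ cubeBudget L₂ M α β Δ := by
  have h1 := sum_cube_le (Fv := fun k => objective f (run f I ξg ξH k).x)
    (s := fun k => ‖(run f I ξg ξH k).s‖) (A := (3 * M - 2 * L₂) / 12) (w := β + α / 2)
    (e := I.ε₁) (D := |Δ|) (n := n) (by positivity) (fun k => norm_nonneg _) he.le hs₀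
    (fun k hk => objective_run_succ_le hN hf hα hβ hsolve he.le (hacc k hk))
    (by
      have h2 := ciInf_le hf.bddBelow (run f I ξg ξH n).x
      have h3 := le_abs_self Δ
      have h4 : objective f (run f I ξg ξH 0).x = objective f I.x₀ := rfl
      simp only [h4]
      linarith)
    (fun k hk => not_le.1 (hns k hk))
  rw [cubeBudget, le_div_iff₀ (by positivity)]
  have h5 : 0 ≤ ∑ k ∈ Finset.range n, ‖(run f I ξg ξH (k + 1)).s‖ ^ 3 :=
    Finset.sum_nonneg fun k _ => by positivity
  have h6 : 2 * gammaConst L₂ M α β ≤ (3 * M - 2 * L₂) / 12 - 4 * (β + α / 2) := by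
    rw [gammaConst]; linarith
  have h7 := mul_le_mul_of_nonneg_right h6 h5
  have h8 : (2 * β + α) * I.ε₁ ^ 3 ≤ (2 * β + α) * tau L₂ M α β ^ 3 := by gcongr
  linarith

/-- The stopping test can fail in at most `iterConst * ε^{-3/2}` consecutive iterations. -/
theorem iteration_count_le (hN : 0 < N) (hf : RegularObjective f L₀ L₁ L₂) (hM : 0 < M)
    (hα : 0 < α) (hβ : 0 < β) (hγ : 0 < gammaConst L₂ M α β)
    (hsolve : IsSubproblemOracle M I.solve) (hε : 0 < ε) (hε1 : ε ≤ 1)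
    (hI : I.ε₁ = tau L₂ M α β * √ε) (hs₀ : ‖I.s₀‖ = I.ε₁)
    (hΔ : objective f I.x₀ - (⨅ x, objective f x) ≤ Δ) {n : ℕ}
    (hacc : ∀ k < n, Accurate f I ξg ξH α β k) (hns : ∀ k < n, ¬ StopTest f I ξg ξH k) :
    (n : ℝ) ≤ iterConst L₂ M α β Δ / ε ^ (3 / 2 : ℝ) := by
  have hτ := tau_pos L₂.coe_nonneg hM hα hβ
  have he : 0 < I.ε₁ := by rw [hI]; positivity
  have hsq1 : √ε ≤ 1 := Real.sqrt_le_one.2 hε1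
  have heτ : I.ε₁ ≤ tau L₂ M α β := by rw [hI]; exact mul_le_of_le_one_right hτ.le hsq1
  have h1 := sum_norm_step_cube_le hN hf hα hβ hγ hsolve he heτ hs₀ hΔ hacc hns
  have h2 := mul_cube_le_of_forall_lt (s := fun k => ‖(run f I ξg ξH k).s‖)
    (fun k => norm_nonneg _) he.le hs₀ (n := n) (fun k hk => not_le.1 (hns k hk))
  have he3 : I.ε₁ ^ 3 = tau L₂ M α β ^ 3 * ε ^ (3 / 2 : ℝ) := by
    rw [hI, mul_pow, sqrt_pow_three hε]
  have hε3 : 0 < ε ^ (3 / 2 : ℝ) := Real.rpow_pos_of_pos hε _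
  have hε31 : ε ^ (3 / 2 : ℝ) ≤ 1 := Real.rpow_le_one hε.le hε1 (by norm_num)
  rw [le_div_iff₀ hε3, iterConst]
  rw [he3] at h2
  have hτ3 : 0 < tau L₂ M α β ^ 3 := by positivity
  have h3 : n * ε ^ (3 / 2 : ℝ) * tau L₂ M α β ^ 3
      ≤ 2 * cubeBudget L₂ M α β Δ + 1 * tau L₂ M α β ^ 3 := by
    have := mul_le_mul_of_nonneg_right hε31 hτ3.le
    linarith
  calc n * ε ^ (3 / 2 : ℝ) ≤ (2 * cubeBudget L₂ M α β Δ + 1 * tau L₂ M α β ^ 3)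
        / tau L₂ M α β ^ 3 := by rwa [le_div_iff₀ hτ3]
    _ = _ := by rw [add_div, mul_div_cancel_right₀ _ hτ3.ne']

theorem approximate_minimizer_of_stopTest (hN : 0 < N) (hf : RegularObjective f L₀ L₁ L₂)
    (hM : 0 < M) (hα : 0 < α) (hβ : 0 < β) (hsolve : IsSubproblemOracle M I.solve) (hε : 0 < ε)
    (hI : I.ε₁ = tau L₂ M α β * √ε) {K : ℕ}
    (hacc : Accurate f I ξg ξH α β K) (htest : StopTest f I ξg ξH K) :
    ‖gradient (objective f) (run f I ξg ξH (K + 1)).x‖ ≤ ε ∧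
      CurvatureAtLeastNeg (hessian (objective f) (run f I ξg ξH (K + 1)).x) (√ε) := by
  have hτ := tau_pos L₂.coe_nonneg hM hα hβ
  have he : 0 < I.ε₁ := by rw [hI]; positivity
  obtain ⟨hs1, hs0⟩ := max_le_iff.1 htest
  have hF := contDiff_objective hf.contDiff
  have hL := lipschitzWith_hessian_objective hN hf.contDiff hf.lipschitz_hessian
  have hH := hessEstimate_isSelfAdjoint (I := I) (k := K) (ξ := ξH K) (σ := run f I ξg ξH K)
    hf.contDiff
  have hmin := run_succ_s_isMin (I := I) (ξg := ξg) (ξH := ξH) hf.contDiff hsolve K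
  have hg : ‖gradEstimate f I K (ξg K) (run f I ξg ξH K)
      - gradient (objective f) (run f I ξg ξH K).x‖ ≤ β * I.ε₁ ^ 2 := by
    have := hacc.1
    rwa [max_eq_right (pow_le_pow_left₀ (norm_nonneg _) hs0 2)] at this
  have hHe : ‖hessEstimate f I K (ξH K) (run f I ξg ξH K)
      - hessian (objective f) (run f I ξg ξH K).x‖ ≤ α * I.ε₁ := by
    have := hacc.2
    rwa [max_eq_right hs0] at this
  rw [run_succ_x]
  have he2 : I.ε₁ ^ 2 = tau L₂ M α β ^ 2 * ε := by
    rw [hI, mul_pow, Real.sq_sqrt hε.le]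
  constructor
  · refine (norm_gradient_step_le hF hL hM hH hmin hg hHe).trans ?_
    calc (L₂ + M) / 2 * ‖(run f I ξg ξH (K + 1)).s‖ ^ 2 + β * I.ε₁ ^ 2
          + α * I.ε₁ * ‖(run f I ξg ξH (K + 1)).s‖
        ≤ (L₂ + M) / 2 * I.ε₁ ^ 2 + β * I.ε₁ ^ 2 + α * I.ε₁ * I.ε₁ := by
          have := L₂.coe_nonneg
          gcongr
      _ ≤ ((L₂ + M) / 2 + 2 * β + 2 * α) * I.ε₁ ^ 2 := by nlinarith [sq_nonneg I.ε₁]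
      _ = ((L₂ + M) / 2 + 2 * β + 2 * α) * tau L₂ M α β ^ 2 * ε := by rw [he2]; ring
      _ ≤ 1 * ε := by gcongr; exact mul_tau_sq_le L₂.coe_nonneg hM hα hβ
      _ = ε := one_mul ε
  · refine curvature_step hL hH hmin hHe ?_
    calc (M + 2 * L₂) / 2 * ‖(run f I ξg ξH (K + 1)).s‖ + α * I.ε₁
        ≤ (M + 2 * L₂) / 2 * I.ε₁ + α * I.ε₁ := by
          have := L₂.coe_nonneg
          gcongr
      _ ≤ ((M + 2 * L₂) / 2 + 2 * α) * I.ε₁ := by nlinarith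
      _ = ((M + 2 * L₂) / 2 + 2 * α) * tau L₂ M α β * √ε := by rw [hI]; ring
      _ ≤ 1 * √ε := by gcongr; exact mul_tau_le L₂.coe_nonneg hM hα
      _ = √ε := one_mul _

end Deterministic

/-! ### The number of sampled Hessians -/

section SampleCount

theorem rpow_third_le_loopLength (N : ℕ) : (N : ℝ) ^ (1 / 3 : ℝ) ≤ loopLength N := Nat.le_ceil _

theorem loopLength_pos {N : ℕ} (hN : 0 < N) : 0 < loopLength N :=
  Nat.ceil_pos.2 (Real.rpow_pos_of_pos (by exact_mod_cast hN) _)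

theorem loopLength_sq_le {N : ℕ} (hN : 0 < N) :
    (loopLength N : ℝ) ^ 2 ≤ 4 * (N : ℝ) ^ (2 / 3 : ℝ) := by
  have hN1 : (1 : ℝ) ≤ N := by exact_mod_cast hN
  have h1 : (1 : ℝ) ≤ (N : ℝ) ^ (1 / 3 : ℝ) := Real.one_le_rpow hN1 (by norm_num)
  have h2 : (loopLength N : ℝ) ≤ 2 * (N : ℝ) ^ (1 / 3 : ℝ) := by
    have := Nat.ceil_lt_add_one (a := (N : ℝ) ^ (1 / 3 : ℝ)) (by positivity)
    rw [loopLength]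
    linarith
  calc (loopLength N : ℝ) ^ 2 ≤ (2 * (N : ℝ) ^ (1 / 3 : ℝ)) ^ 2 := by gcongr
    _ = 4 * (N : ℝ) ^ (2 / 3 : ℝ) := by
      rw [mul_pow, ← Real.rpow_natCast ((N : ℝ) ^ (1 / 3 : ℝ)), ← Real.rpow_mul (by positivity)]
      norm_num

theorem le_loopLength_mul {N : ℕ} (hN : 0 < N) :
    (N : ℝ) ≤ loopLength N * (N : ℝ) ^ (2 / 3 : ℝ) := by
  have hN0 : (0 : ℝ) < N := by exact_mod_cast hN
  calc (N : ℝ) = (N : ℝ) ^ (1 / 3 : ℝ) * (N : ℝ) ^ (2 / 3 : ℝ) := by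
        rw [← Real.rpow_add hN0]; norm_num
    _ ≤ _ := by gcongr; exact rpow_third_le_loopLength N

/-- Summing batch sizes that are at most `2 + (A₀ + A₁ r²) ℓ`, and `N` in every `m`-th iteration. -/
theorem sum_batch_le {n : ℕ → ℕ} {r : ℕ → ℝ} {N m : ℕ} {A₀ A₁ l Q : ℝ} (hm : 0 < m)
    (hA₀ : 0 ≤ A₀) (hA₁ : 0 ≤ A₁) (hl : 0 ≤ l) (hN : (N : ℝ) ≤ m * Q)
    (hn0 : ∀ k, k % m = 0 → n k = N)
    (hn : ∀ k, k % m ≠ 0 → (n k : ℝ) ≤ 2 + (A₀ + A₁ * r k ^ 2) * l) (K : ℕ) :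
    ((∑ k ∈ Finset.Icc 1 K, n k : ℕ) : ℝ)
      ≤ K * Q + (2 * K + (A₀ * K + A₁ * ∑ k ∈ Finset.Icc 1 K, r k ^ 2) * l) := by
  have hm' : (0 : ℝ) < m := by exact_mod_cast hm
  have hQ : 0 ≤ Q := nonneg_of_mul_nonneg_right ((Nat.cast_nonneg N).trans hN) hm'
  have hcard : ((Finset.Icc 1 K).filter (fun k => m ∣ k)).card = K / m :=
    Nat.Ioc_filter_dvd_card_eq_div K m
  have hfull : ∑ k ∈ Finset.Icc 1 K, (if m ∣ k then (N : ℝ) else 0) ≤ K * Q := by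
    rw [← Finset.sum_filter, Finset.sum_const, hcard, nsmul_eq_mul]
    calc ((K / m : ℕ) : ℝ) * N ≤ (K / m : ℝ) * (m * Q) := by
          gcongr; exact Nat.cast_div_le
      _ = K * Q := by field_simp
  have hterm : ∀ k ∈ Finset.Icc 1 K, (n k : ℝ)
      ≤ (if m ∣ k then (N : ℝ) else 0) + (2 + (A₀ + A₁ * r k ^ 2) * l) := by
    intro k _
    have : 0 ≤ 2 + (A₀ + A₁ * r k ^ 2) * l := by positivity
    by_cases hk : m ∣ k
    · rw [if_pos hk, hn0 k (Nat.mod_eq_zero_of_dvd hk)]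
      linarith
    · rw [if_neg hk, zero_add]
      exact hn k fun h => hk (Nat.dvd_of_mod_eq_zero h)
  push_cast
  refine (Finset.sum_le_sum hterm).trans ?_
  rw [Finset.sum_add_distrib]
  refine add_le_add hfull (le_of_eq ?_)
  rw [Finset.sum_add_distrib, ← Finset.sum_mul, Finset.sum_add_distrib, ← Finset.mul_sum,
    Finset.sum_const, Finset.sum_const, Nat.card_Icc, Nat.add_sub_cancel, nsmul_eq_mul,
    nsmul_eq_mul]
  ring

theorem log_batch_le {c : ℝ} (hc : 0 < c) (hc4 : c ≤ 4) {d : ℕ} (hd : 0 < d) {ε δ : ℝ}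
    (hε : 0 < ε) (hε1 : ε ≤ 1) (hδ : 0 < δ) (hδ1 : δ < 1) :
    1 ≤ Real.log (8 * d / (ε * δ)) ∧
    Real.log (4 * d / (c * ε ^ (3 / 2 : ℝ) * δ))
      ≤ (3 / 2 + Real.log (4 / c)) * Real.log (8 * d / (ε * δ)) := by
  have hd1 : (1 : ℝ) ≤ d := by exact_mod_cast hd
  have hd0 : (0 : ℝ) < d := by linarith
  have e1 : Real.log (8 * d / (ε * δ))
      = Real.log 8 + Real.log d - Real.log ε - Real.log δ := by
    rw [Real.log_div (by positivity) (by positivity), Real.log_mul (by norm_num) hd0.ne',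
      Real.log_mul hε.ne' hδ.ne']
    ring
  have e2 : Real.log (4 * d / (c * ε ^ (3 / 2 : ℝ) * δ))
      = Real.log (4 / c) + Real.log d - 3 / 2 * Real.log ε - Real.log δ := by
    rw [Real.log_div (by positivity) (by positivity), Real.log_mul (by norm_num) hd0.ne',
      Real.log_mul (by positivity) hδ.ne', Real.log_mul hc.ne' (by positivity),
      Real.log_rpow hε, Real.log_div (by norm_num) hc.ne']
    ring
  have h8 : 1 ≤ Real.log 8 := by
    rw [Real.le_log_iff_exp_le (by norm_num)]
    linarith [Real.exp_one_lt_d9]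
  have hd' : 0 ≤ Real.log d := Real.log_nonneg hd1
  have hε' : Real.log ε ≤ 0 := Real.log_nonpos hε.le hε1
  have hδ' : Real.log δ ≤ 0 := Real.log_nonpos hδ.le hδ1.le
  have h4 : 0 ≤ Real.log (4 / c) := Real.log_nonneg (by rwa [one_le_div hc])
  have hΛ : 1 ≤ Real.log (8 * d / (ε * δ)) := by rw [e1]; linarith
  refine ⟨hΛ, ?_⟩
  have h5 := mul_le_mul_of_nonneg_left hΛ h4
  rw [add_mul]
  refine le_trans ?_ (add_le_add_right h5 _)
  rw [e1, e2]
  linarith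

variable {d N : ℕ} {f : Fin N → Vec d → ℝ} {I : Input d} {ξg ξH : ℕ → ℕ → Fin N}

theorem sum_sq_drift_run_le (hm : 0 < I.m) (he : 0 < I.ε₁) (K : ℕ) :
    ∑ k ∈ Finset.Icc 1 K,
        (‖(run f I ξg ξH k).x - snapshot I k (run f I ξg ξH k)‖ / I.ε₁) ^ 2
      ≤ (I.m : ℝ) ^ 2 *
        (K + (∑ k ∈ Finset.range K, ‖(run f I ξg ξH (k + 1)).s‖ ^ 3) / I.ε₁ ^ 3) := by
  have h1 := sum_sq_drift_le (m := I.m)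
    (r := fun k => ‖(run f I ξg ξH k).x - snapshot I k (run f I ξg ξH k)‖)
    (s := fun k => ‖(run f I ξg ξH k).s‖) hm (fun k => norm_nonneg _)
    (fun k hk => by simp [snapshot, hk])
    (fun k hk => by
      have e : snapshot I (k + 1) (run f I ξg ξH (k + 1)) = snapshot I k (run f I ξg ξH k) := by
        rw [snapshot, if_neg hk]; rfl
      simp only [e]
      rw [run_succ_x, add_sub_right_comm]
      exact norm_add_le _ _) K
  have h2 := sum_sq_div_le (s := fun k => ‖(run f I ξg ξH k).s‖) he (fun k => norm_nonneg _) K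
  simp only [div_pow, ← Finset.sum_div]
  calc _ ≤ ((I.m : ℝ) ^ 2 * ∑ k ∈ Finset.Icc 1 K, ‖(run f I ξg ξH k).s‖ ^ 2) / I.ε₁ ^ 2 := by
        gcongr
    _ = (I.m : ℝ) ^ 2 * ((∑ k ∈ Finset.Icc 1 K, ‖(run f I ξg ξH k).s‖ ^ 2) / I.ε₁ ^ 2) := by
        ring
    _ ≤ _ := by gcongr

end SampleCount

/-! ### The complexity bound -/

section Complexity

/-- The constant in the failure level `ζ` of a single estimate. -/
noncomputable def failConst (L₂ M α β Δ : ℝ) : ℝ := (10 * (iterConst L₂ M α β Δ + 1))⁻¹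

/-- The ratio allowed between the logarithm in the batch sizes and `log (8 d / (ε δ))`. -/
noncomputable def logConst (L₂ M α β Δ : ℝ) : ℝ := 3 / 2 + Real.log (4 / failConst L₂ M α β Δ)

/-- The constant in the Hessian sample complexity. -/
noncomputable def sampleConst (L₂ M α β Δ : ℝ) : ℝ :=
  iterConst L₂ M α β Δ *
    (3 + (4 * L₂ / (3 * α) + 8 * (8 * L₂ ^ 2 / α ^ 2 + 4 * L₂ / (3 * α))) * logConst L₂ M α β Δ)

variable {L₂ M α β : ℝ}

theorem failConst_pos (Δ : ℝ) (hL : 0 ≤ L₂) (hM : 0 < M) (hα : 0 < α) (hβ : 0 < β)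
    (hγ : 0 < gammaConst L₂ M α β) : 0 < failConst L₂ M α β Δ := by
  have := one_le_iterConst Δ hL hM hα hβ hγ
  rw [failConst]
  positivity

theorem failConst_le (Δ : ℝ) (hL : 0 ≤ L₂) (hM : 0 < M) (hα : 0 < α) (hβ : 0 < β)
    (hγ : 0 < gammaConst L₂ M α β) : failConst L₂ M α β Δ ≤ 1 / 10 := by
  have := one_le_iterConst Δ hL hM hα hβ hγ
  rw [failConst, one_div]
  exact inv_anti₀ (by norm_num) (by linarith)

theorem logConst_pos (Δ : ℝ) (hL : 0 ≤ L₂) (hM : 0 < M) (hα : 0 < α) (hβ : 0 < β)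
    (hγ : 0 < gammaConst L₂ M α β) : 0 < logConst L₂ M α β Δ := by
  have h1 := failConst_pos Δ hL hM hα hβ hγ
  have h2 := failConst_le Δ hL hM hα hβ hγ
  have : 0 ≤ Real.log (4 / failConst L₂ M α β Δ) :=
    Real.log_nonneg (by rw [one_le_div h1]; linarith)
  rw [logConst]
  linarith

theorem sampleConst_pos (Δ : ℝ) (hL : 0 ≤ L₂) (hM : 0 < M) (hα : 0 < α) (hβ : 0 < β)
    (hγ : 0 < gammaConst L₂ M α β) : 0 < sampleConst L₂ M α β Δ := by
  have := one_le_iterConst Δ hL hM hα hβ hγ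
  have := logConst_pos Δ hL hM hα hβ hγ
  rw [sampleConst]
  positivity

variable {d N : ℕ} {f : Fin N → Vec d → ℝ} {L₀ L₁ L₂ : ℝ≥0} {M α β Δ ε δ : ℝ}
  {ξg ξH : ℕ → ℕ → Fin N} {x₀ s₀ : Vec d} {solve : Vec d → Op d → Vec d}
  {I : Input d}

theorem weighted_sample_bound {A₀ A₁ X c Q Λ K l R : ℝ} (hA₀ : 0 ≤ A₀) (hA₁ : 0 ≤ A₁) (hX : 0 ≤ X)
    (hc : 0 ≤ c) (hQ : 1 ≤ Q) (hΛ : 1 ≤ Λ) (hKX : K ≤ X) (hl : 0 ≤ l)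
    (hlc : l ≤ c * Λ) (hRX : R ≤ 4 * Q * (X + X)) :
    K * Q + (2 * K + (A₀ * K + A₁ * R) * l) ≤ X * (3 + (A₀ + 8 * A₁) * c) * Q * Λ := by
  have hQ0 : 0 ≤ Q := by linarith
  have h1 : Q ≤ Q * Λ := le_mul_of_one_le_right hQ0 hΛ
  have h2 : X ≤ X * (Q * Λ) := le_mul_of_one_le_right hX (one_le_mul_of_one_le_of_one_le hQ hΛ)
  have h3 : X ≤ X * Q := le_mul_of_one_le_right hX hQ
  calc K * Q + (2 * K + (A₀ * K + A₁ * R) * l)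
      ≤ X * Q + (2 * X + (A₀ * X + A₁ * (4 * Q * (X + X))) * (c * Λ)) := by gcongr
    _ ≤ X * (Q * Λ) + (2 * (X * (Q * Λ)) + (A₀ * (X * Q) + A₁ * (4 * Q * (X + X))) *
          (c * Λ)) := by gcongr
    _ = _ := by ring

/-- If all estimates are accurate up to the bound on the iteration count, the algorithm stops. -/
theorem exists_stopsAt (hM : 0 < M) (hα : 0 < α) (hβ : 0 < β)
    (hγ : 0 < gammaConst L₂ M α β) (hN : 0 < N) (hf : RegularObjective f L₀ L₁ L₂)
    (hsolve : IsSubproblemOracle M I.solve) (hε : 0 < ε) (hε1 : ε ≤ 1)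
    (hI : I.ε₁ = tau L₂ M α β * √ε) (hs₀ : ‖I.s₀‖ = I.ε₁)
    (hΔ : objective f I.x₀ - (⨅ x, objective f x) ≤ Δ)
    (hacc : ∀ k ≤ ⌊iterConst L₂ M α β Δ / ε ^ (3 / 2 : ℝ)⌋₊, Accurate f I ξg ξH α β k) :
    ∃ K ≤ ⌊iterConst L₂ M α β Δ / ε ^ (3 / 2 : ℝ)⌋₊, StopsAt f I ξg ξH K := by
  classical
  set T := ⌊iterConst L₂ M α β Δ / ε ^ (3 / 2 : ℝ)⌋₊ with hT
  obtain ⟨k, hkT, hk⟩ : ∃ k ≤ T, StopTest f I ξg ξH k := by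
    by_contra! h
    have h1 := iteration_count_le hN hf hM hα hβ hγ hsolve hε hε1 hI hs₀ hΔ (n := T + 1)
      (fun k hk => hacc k (Nat.lt_succ_iff.1 hk)) (fun k hk => h k (Nat.lt_succ_iff.1 hk))
    have h2 := Nat.lt_floor_add_one (iterConst L₂ M α β Δ / ε ^ (3 / 2 : ℝ))
    push_cast at h1
    exact absurd h1 (not_le.2 h2)
  have hex : ∃ k, StopTest f I ξg ξH k := ⟨k, hk⟩
  exact ⟨Nat.find hex, (Nat.find_min' hex hk).trans hkT, Nat.find_spec hex,
    fun j hj => Nat.find_min hex hj⟩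

theorem sum_hessSamples_le (hα : 0 < α) (hN : 0 < N) (he : 0 < I.ε₁) (hm : I.m = loopLength N)
    {ζ : ℝ} (hH : I.hessBatch = hessBatchSize d L₂ α I.ε₁ ζ) (hl : 0 ≤ Real.log (4 * d / ζ))
    {X : ℝ} {K : ℕ} (hKX : (K : ℝ) ≤ X)
    (hcube : (∑ k ∈ Finset.range K, ‖(run f I ξg ξH (k + 1)).s‖ ^ 3) / I.ε₁ ^ 3 ≤ X)
    {c Λ : ℝ} (hc : 0 ≤ c) (hΛ : 1 ≤ Λ) (hlog : Real.log (4 * d / ζ) ≤ c * Λ) :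
    ((∑ i ∈ Finset.Icc 1 K, hessSamples f I ξg ξH i : ℕ) : ℝ)
      ≤ X * (3 + (4 * L₂ / (3 * α) + 8 * (8 * L₂ ^ 2 / α ^ 2 + 4 * L₂ / (3 * α))) * c)
        * (N : ℝ) ^ (2 / 3 : ℝ) * Λ := by
  have hA₀ : (0 : ℝ) ≤ 4 * L₂ / (3 * α) := by positivity
  have hA₁ : (0 : ℝ) ≤ 8 * L₂ ^ 2 / α ^ 2 + 4 * L₂ / (3 * α) := by positivity
  have hQ : 1 ≤ (N : ℝ) ^ (2 / 3 : ℝ) := Real.one_le_rpow (by exact_mod_cast hN) (by norm_num)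
  have hX : 0 ≤ X := (Nat.cast_nonneg K).trans hKX
  have hm0 : 0 < I.m := by rw [hm]; exact loopLength_pos hN
  have hdrift := sum_sq_drift_run_le (f := f) (ξg := ξg) (ξH := ξH) hm0 he K
  have hcount := sum_batch_le (n := hessSamples f I ξg ξH) (N := N) (m := I.m)
    (r := fun k => ‖(run f I ξg ξH k).x - snapshot I k (run f I ξg ξH k)‖ / I.ε₁)
    hm0 hA₀ hA₁ hl (by rw [hm]; exact le_loopLength_mul hN)
    (fun k hk => by rw [hessSamples, if_pos hk])
    (fun k hk => by
      rw [hessSamples, if_neg hk, hH, div_pow]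
      exact hessBatchSize_le L₂.coe_nonneg hα he hl) K
  refine hcount.trans (weighted_sample_bound hA₀ hA₁ hX hc hQ hΛ hKX hl hlog (hdrift.trans ?_))
  rw [hm]
  exact mul_le_mul (loopLength_sq_le hN) (add_le_add hKX hcube) (by positivity) (by positivity)

/-- The conclusion for a single realization of the samples whose estimates are accurate in every
iteration that can be reached. -/
theorem conclusion_of_accurate (hM : 0 < M) (hα : 0 < α) (hβ : 0 < β)
    (hγ : 0 < gammaConst L₂ M α β) (hd : 0 < d) (hN : 0 < N)
    (hf : RegularObjective f L₀ L₁ L₂) (hΔ : objective f x₀ - (⨅ x, objective f x) ≤ Δ)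
    (hε : 0 < ε) (hε1 : ε ≤ 1) (hδ : 0 < δ) (hδ1 : δ < 1) (hs₀ : ‖s₀‖ = tau L₂ M α β * √ε)
    (hsolve : IsSubproblemOracle M solve)
    (hI : I = input N L₁ L₂ M α β ε (failConst L₂ M α β Δ * ε ^ (3 / 2 : ℝ) * δ) x₀ s₀ solve)
    (hacc : ∀ k ≤ ⌊iterConst L₂ M α β Δ / ε ^ (3 / 2 : ℝ)⌋₊, Accurate f I ξg ξH α β k) :
    ∃ K : ℕ, StopsAt f I ξg ξH K ∧
      ‖gradient (objective f) (run f I ξg ξH (K + 1)).x‖ ≤ ε ∧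
      CurvatureAtLeastNeg (hessian (objective f) (run f I ξg ξH (K + 1)).x) (√ε) ∧
      ((∑ i ∈ Finset.Icc 1 K, hessSamples f I ξg ξH i : ℕ) : ℝ)
        ≤ sampleConst L₂ M α β Δ * (N : ℝ) ^ (2 / 3 : ℝ) / ε ^ (3 / 2 : ℝ) *
          Real.log (8 * d / (ε * δ)) := by
  have hτ := tau_pos L₂.coe_nonneg hM hα hβ
  have hIe : I.ε₁ = tau L₂ M α β * √ε := by rw [hI]; rfl
  have hIm : I.m = loopLength N := by rw [hI]; rfl
  have hIx : I.x₀ = x₀ := by rw [hI]; rfl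
  have hIs : ‖I.s₀‖ = I.ε₁ := by rw [hIe, ← hs₀, hI]; rfl
  have hIsolve : IsSubproblemOracle M I.solve := by rw [hI]; exact hsolve
  have hIH : I.hessBatch = hessBatchSize d L₂ α I.ε₁
      (failConst L₂ M α β Δ * ε ^ (3 / 2 : ℝ) * δ) := by rw [hIe, hI]; rfl
  rw [← hIx] at hΔ
  have he : 0 < I.ε₁ := by rw [hIe]; positivity
  have heτ : I.ε₁ ≤ tau L₂ M α β := by
    rw [hIe]; exact mul_le_of_le_one_right hτ.le (Real.sqrt_le_one.2 hε1)
  have hε3 : 0 < ε ^ (3 / 2 : ℝ) := Real.rpow_pos_of_pos hε _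
  have hC₁ := one_le_iterConst Δ L₂.coe_nonneg hM hα hβ hγ
  obtain ⟨K, hKT, htest, hmin⟩ := exists_stopsAt hM hα hβ hγ hN hf hIsolve hε hε1 hIe hIs hΔ hacc
  obtain ⟨hgrad, hcurv⟩ := approximate_minimizer_of_stopTest hN hf hM hα hβ hIsolve hε hIe
    (hacc K hKT) htest
  refine ⟨K, ⟨htest, hmin⟩, hgrad, hcurv, ?_⟩
  have hcube := sum_norm_step_cube_le hN hf hα hβ hγ hIsolve he heτ hIs hΔ (n := K)
    (fun k hk => hacc k (hk.le.trans hKT)) hmin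
  have hKX : (K : ℝ) ≤ iterConst L₂ M α β Δ / ε ^ (3 / 2 : ℝ) :=
    (Nat.cast_le.2 hKT).trans (Nat.floor_le (by positivity))
  have hBX : (∑ k ∈ Finset.range K, ‖(run f I ξg ξH (k + 1)).s‖ ^ 3) / I.ε₁ ^ 3
      ≤ iterConst L₂ M α β Δ / ε ^ (3 / 2 : ℝ) := by
    have h0 := cubeBudget_nonneg Δ L₂.coe_nonneg hM hα hβ hγ
    calc _ ≤ cubeBudget L₂ M α β Δ / I.ε₁ ^ 3 := by gcongr
      _ = (cubeBudget L₂ M α β Δ / tau L₂ M α β ^ 3) / ε ^ (3 / 2 : ℝ) := by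
        rw [hIe, mul_pow, sqrt_pow_three hε, div_div]
      _ ≤ iterConst L₂ M α β Δ / ε ^ (3 / 2 : ℝ) := by
        gcongr
        rw [iterConst, mul_div_assoc]
        have : 0 ≤ cubeBudget L₂ M α β Δ / tau L₂ M α β ^ 3 := by positivity
        linarith
  have hfail := failConst_pos Δ L₂.coe_nonneg hM hα hβ hγ
  have hfail' := failConst_le Δ L₂.coe_nonneg hM hα hβ hγ
  obtain ⟨hΛ, hlog⟩ := log_batch_le hfail (by linarith) hd hε hε1 hδ hδ1
  have hlog0 : 0 ≤ Real.log (4 * d / (failConst L₂ M α β Δ * ε ^ (3 / 2 : ℝ) * δ)) := by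
    refine Real.log_nonneg ?_
    rw [one_le_div (by positivity)]
    have hd1 : (1 : ℝ) ≤ d := by exact_mod_cast hd
    have h1 : ε ^ (3 / 2 : ℝ) ≤ 1 := Real.rpow_le_one hε.le hε1 (by norm_num)
    calc failConst L₂ M α β Δ * ε ^ (3 / 2 : ℝ) * δ ≤ 1 / 10 * 1 * 1 := by gcongr
      _ ≤ 4 * (d : ℝ) := by linarith
  refine (sum_hessSamples_le hα hN he hIm hIH hlog0 hKX hBX
    (logConst_pos Δ L₂.coe_nonneg hM hα hβ hγ).le hΛ hlog).trans (le_of_eq ?_)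
  rw [sampleConst]
  ring

end Complexity

end SVRC

theorem theorem3 (L₂ : ℝ≥0) (M α β Δ : ℝ) (hM : 0 < M) (hα : 0 < α) (hβ : 0 < β)
    (hγ : 0 < SVRC.gammaConst L₂ M α β) :
    ∃ C > (0 : ℝ), ∃ c > (0 : ℝ),
      ∀ (L₀ L₁ : ℝ≥0) (d N : ℕ), 0 < d → 0 < N →
      ∀ f : Fin N → SVRC.Vec d → ℝ, SVRC.RegularObjective f L₀ L₁ L₂ →
      ∀ x₀ : SVRC.Vec d, SVRC.objective f x₀ - (⨅ x, SVRC.objective f x) ≤ Δ →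
      ∀ ε δ : ℝ, 0 < ε → ε ≤ 1 → 0 < δ → δ < 1 →
      ∀ s₀ : SVRC.Vec d, ‖s₀‖ = SVRC.tau L₂ M α β * √ε →
      ∀ solve : SVRC.Vec d → SVRC.Op d → SVRC.Vec d, SVRC.IsSubproblemOracle M solve →
      ∀ I : SVRC.Input d,
        I = SVRC.input N L₁ L₂ M α β ε (c * ε ^ (3 / 2 : ℝ) * δ) x₀ s₀ solve →
      ∀ (Ω : Type*) [MeasurableSpace Ω] (P : Measure Ω) [IsProbabilityMeasure P]
        (ξg ξH : ℕ → ℕ → Ω → Fin N), SVRC.UniformSampling P ξg ξH →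
        ENNReal.ofReal (1 - δ) ≤ P {ω | ∃ K : ℕ,
          SVRC.StopsAt f I (fun k j => ξg k j ω) (fun k j => ξH k j ω) K ∧
          ‖gradient (SVRC.objective f)
            (SVRC.run f I (fun k j => ξg k j ω) (fun k j => ξH k j ω) (K + 1)).x‖ ≤ ε ∧
          SVRC.CurvatureAtLeastNeg (SVRC.hessian (SVRC.objective f)
            (SVRC.run f I (fun k j => ξg k j ω) (fun k j => ξH k j ω) (K + 1)).x) (√ε) ∧
          ((∑ i ∈ Finset.Icc 1 K,
              SVRC.hessSamples f I (fun k j => ξg k j ω) (fun k j => ξH k j ω) i : ℕ) : ℝ)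
            ≤ C * (N : ℝ) ^ (2 / 3 : ℝ) / ε ^ (3 / 2 : ℝ) * Real.log (8 * d / (ε * δ))} := by
  refine ⟨SVRC.sampleConst L₂ M α β Δ, SVRC.sampleConst_pos Δ L₂.coe_nonneg hM hα hβ hγ,
    SVRC.failConst L₂ M α β Δ, SVRC.failConst_pos Δ L₂.coe_nonneg hM hα hβ hγ, ?_⟩
  intro L₀ L₁ d N hd hN f hf x₀ hΔ ε δ hε hε1 hδ hδ1 s₀ hs₀ solve hsolve I hI Ω _ P _ ξg ξH hU
  have hτ := SVRC.tau_pos L₂.coe_nonneg hM hα hβ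
  have hfail := SVRC.failConst_pos Δ L₂.coe_nonneg hM hα hβ hγ
  have hfail' := SVRC.failConst_le Δ L₂.coe_nonneg hM hα hβ hγ
  have hIe : I.ε₁ = SVRC.tau L₂ M α β * √ε := by rw [hI]; rfl
  have he : 0 < I.ε₁ := by rw [hIe]; positivity
  have hε3 : 0 < ε ^ (3 / 2 : ℝ) := Real.rpow_pos_of_pos hε _
  have hε31 : ε ^ (3 / 2 : ℝ) ≤ 1 := Real.rpow_le_one hε.le hε1 (by norm_num)
  set ζ := SVRC.failConst L₂ M α β Δ * ε ^ (3 / 2 : ℝ) * δ with hζdef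
  have hζ : 0 < ζ := by positivity
  have hζ' : ζ ≤ 1 / 10 := by
    calc ζ ≤ 1 / 10 * 1 * 1 := by rw [hζdef]; gcongr
      _ = 1 / 10 := by norm_num
  set T := ⌊SVRC.iterConst L₂ M α β Δ / ε ^ (3 / 2 : ℝ)⌋₊ with hT
  have hgb := SVRC.measureReal_gradEstimate_bad_le hU hN hd hf hβ he hζ hζ' (I := I)
    (by rw [hIe, hI]; rfl)
  have hhb := SVRC.measureReal_hessEstimate_bad_le hU hN hd hf hα he hζ hζ' (I := I)
    (by rw [hIe, hI]; rfl)
  set Bg : ℕ → Set Ω := fun k =>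
    {ω | β * max (‖(SVRC.run f I (fun k j => ξg k j ω) (fun k j => ξH k j ω) k).s‖ ^ 2) (I.ε₁ ^ 2)
      < ‖SVRC.gradEstimate f I k (fun j => ξg k j ω)
          (SVRC.run f I (fun k j => ξg k j ω) (fun k j => ξH k j ω) k)
        - gradient (SVRC.objective f)
          (SVRC.run f I (fun k j => ξg k j ω) (fun k j => ξH k j ω) k).x‖} with hBg
  set Bh : ℕ → Set Ω := fun k =>
    {ω | α * max ‖(SVRC.run f I (fun k j => ξg k j ω) (fun k j => ξH k j ω) k).s‖ I.ε₁
      < ‖SVRC.hessEstimate f I k (fun j => ξH k j ω)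
          (SVRC.run f I (fun k j => ξg k j ω) (fun k j => ξH k j ω) k)
        - SVRC.hessian (SVRC.objective f)
          (SVRC.run f I (fun k j => ξg k j ω) (fun k j => ξH k j ω) k).x‖} with hBh
  set Bad : Set Ω := ⋃ k ∈ Finset.range (T + 1), (Bg k ∪ Bh k) with hBad
  have hPBad : P.real Bad ≤ δ := by
    calc P.real Bad ≤ ∑ k ∈ Finset.range (T + 1), P.real (Bg k ∪ Bh k) :=
          measureReal_biUnion_finset_le _ _
      _ ≤ ∑ k ∈ Finset.range (T + 1), ζ := Finset.sum_le_sum fun k _ => by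
          have := measureReal_union_le (μ := P) (Bg k) (Bh k)
          linarith [hgb k, hhb k]
      _ = (T + 1) * ζ := by simp
      _ ≤ ((SVRC.iterConst L₂ M α β Δ + 1) / ε ^ (3 / 2 : ℝ)) * ζ := by
          gcongr
          have h1 : (T : ℝ) ≤ SVRC.iterConst L₂ M α β Δ / ε ^ (3 / 2 : ℝ) := by
            have := SVRC.one_le_iterConst Δ L₂.coe_nonneg hM hα hβ hγ
            exact Nat.floor_le (by positivity)
          have h2 : 1 ≤ 1 / ε ^ (3 / 2 : ℝ) := by rwa [one_le_div hε3]
          rw [add_div]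
          linarith
      _ = 1 / 10 * δ := by
          have := SVRC.one_le_iterConst Δ L₂.coe_nonneg hM hα hβ hγ
          have hne : SVRC.iterConst L₂ M α β Δ + 1 ≠ 0 := by linarith
          rw [hζdef, SVRC.failConst]
          field_simp
      _ ≤ δ := by linarith
  set Good : Set Ω := {ω | ∃ K : ℕ,
          SVRC.StopsAt f I (fun k j => ξg k j ω) (fun k j => ξH k j ω) K ∧
          ‖gradient (SVRC.objective f)
            (SVRC.run f I (fun k j => ξg k j ω) (fun k j => ξH k j ω) (K + 1)).x‖ ≤ ε ∧
          SVRC.CurvatureAtLeastNeg (SVRC.hessian (SVRC.objective f)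
            (SVRC.run f I (fun k j => ξg k j ω) (fun k j => ξH k j ω) (K + 1)).x) (√ε) ∧
          ((∑ i ∈ Finset.Icc 1 K,
              SVRC.hessSamples f I (fun k j => ξg k j ω) (fun k j => ξH k j ω) i : ℕ) : ℝ)
            ≤ SVRC.sampleConst L₂ M α β Δ * (N : ℝ) ^ (2 / 3 : ℝ) / ε ^ (3 / 2 : ℝ)
              * Real.log (8 * d / (ε * δ))} with hGood
  have hcover : Set.univ ⊆ Good ∪ Bad := by
    intro ω _
    by_cases hω : ω ∈ Bad
    · exact Or.inr hω
    · refine Or.inl (SVRC.conclusion_of_accurate hM hα hβ hγ hd hN hf hΔ hε hε1 hδ hδ1 hs₀ hsolve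
        hI fun k hk => ?_)
      have hk' : ω ∉ Bg k ∪ Bh k := fun h =>
        hω (Set.mem_biUnion (Finset.mem_coe.2 (Finset.mem_range.2 (Nat.lt_succ_of_le hk))) h)
      exact ⟨not_lt.1 fun h => hk' (Or.inl h), not_lt.1 fun h => hk' (Or.inr h)⟩
  have h1 : 1 ≤ P.real Good + P.real Bad := by
    calc (1 : ℝ) = P.real Set.univ := by simp
      _ ≤ P.real (Good ∪ Bad) := measureReal_mono hcover (measure_ne_top _ _)
      _ ≤ _ := measureReal_union_le _ _
  exact ENNReal.ofReal_le_of_le_toReal (by rw [measureReal_def] at h1; linarith)
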